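/- All graphs are finite, non-empty, and have neither loops nor parallel edges; every edge of a directed graph carries exactly one orientation. Undirected notions (connected, outerplanar, block, $2$-tree) are applied to a directed graph through its underlying undirected graph. A graph is \emph{outerplanar} if it admits a plane drawing with all vertices incident to the outer face. A \emph{block} of a connected graph is either a bridge or a maximal $2$-connected subgraph. A \emph{DAG} is a directed graph without directed cycles. A directed graph $B$ is a \emph{monotone directed $2$-tree} if it can be constructed as follows: start with a single directed edge $xy$ (the base edge), and repeatedly choose an edge of the current graph, directed from $v$ to $w$ say, and add a new vertex $u$ together with either the two edges $uv$ and $uw$ (both directed away from $u$) or the two edges $vu$ and $wu$ (both directed towards $u$). A connected outerplanar DAG is \emph{block-monotone} if each of its blocks, with the inherited orientations, is a monotone directed $2$-tree. For an integer $k\ge 1$, a \emph{$k$-stack layout} of a DAG $G$ consists of a total order $\prec$ of $V(G)$ such that $a\prec b$ for every edge directed from $a$ to $b$, and a partition of $E(G)$ into $k$ (possibly empty) parts such that no two edges $ab$, $cd$ of the same part cross, i.e. satisfy $a\prec c\prec b\prec d$ or $c\prec a\prec d\prec b$. \textbf{Corollary.} Every block-monotone outerplanar DAG admits a $258$-stack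 layout. -/

import Mathlib

/-! ### Outerplanar graphs -/

/-- A plane drawing of a simple graph (the plane is `ℂ`): distinct vertices are distinct points,
every edge is a simple arc joining its two endpoints, no edge passes through a further vertex, and
two different edges have no point in common except vertices. -/
structure PlaneDrawing {V : Type*} (G : SimpleGraph V) where
  pos : V → ℂ
  pos_injective : Function.Injective pos
  arc : ∀ u v : V, G.Adj u v → Path (pos u) (pos v)
  arc_symm : ∀ (u v : V) (h : G.Adj u v), arc v u h.symm = (arc u v h).symm
  arc_injective : ∀ (u v : V) (h : G.Adj u v), Function.Injective (arc u v h)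
  vertex_on_arc : ∀ (u v : V) (h : G.Adj u v) (w : V),
    pos w ∈ Set.range (arc u v h) → w = u ∨ w = v
  arc_inter_arc : ∀ (u v : V) (h : G.Adj u v) (u' v' : V) (h' : G.Adj u' v'),
    s(u, v) ≠ s(u', v') →
      Set.range (arc u v h) ∩ Set.range (arc u' v' h') ⊆ Set.range pos

/-- The set of all points of the plane covered by a drawing. -/
def PlaneDrawing.support {V : Type*} {G : SimpleGraph V} (Γ : PlaneDrawing G) : Set ℂ :=
  Set.range Γ.pos ∪ {z | ∃ (u v : V) (h : G.Adj u v), z ∈ Set.range (Γ.arc u v h)}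

/-- The outer face: the unbounded connected component of the complement of the drawing. -/
def PlaneDrawing.outerFace {V : Type*} {G : SimpleGraph V} (Γ : PlaneDrawing G) : Set ℂ :=
  {z | z ∈ Γ.supportᶜ ∧ ¬ Bornology.IsBounded (connectedComponentIn Γ.supportᶜ z)}

/-- A graph is outerplanar if it has a plane drawing with all vertices incident to the outer
face. -/
def IsOuterplanar {V : Type*} (G : SimpleGraph V) : Prop :=
  ∃ Γ : PlaneDrawing G, ∀ v : V, Γ.pos v ∈ closure Γ.outerFace

/-! ### Blocks -/

/-- `2`-connected: at least three vertices, connected, and connected after the removal of any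
one vertex. -/
def IsTwoConnected {W : Type*} (H : SimpleGraph W) : Prop :=
  3 ≤ ENat.card W ∧ H.Connected ∧ ∀ w : W, (H.induce {w}ᶜ).Connected

/-- A block is either a bridge (with its two endpoints) or a maximal `2`-connected subgraph. -/
def IsBlock {V : Type*} (G : SimpleGraph V) (B : G.Subgraph) : Prop :=
  (∃ (u v : V) (h : G.Adj u v), G.IsBridge s(u, v) ∧ B = G.subgraphOfAdj h) ∨
    Maximal (fun B' : G.Subgraph => IsTwoConnected B'.coe) B

/-! ### Directed `2`-trees -/

/-- The four ways in which a new vertex can be stacked onto a directed edge. -/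
inductive Stacking
  | cyclic
  | transitive
  | leftChild
  | rightChild

/-- The two new edges when `u` is stacked onto the directed edge from `v` to `w`;
a pair `(a, b)` is the edge from `a` to `b`. -/
def Stacking.newEdges {V : Type*} (u v w : V) : Stacking → Set (V × V)
  | .cyclic => {(w, u), (u, v)}
  | .transitive => {(v, u), (u, w)}
  | .leftChild => {(u, v), (u, w)}
  | .rightChild => {(v, u), (w, u)}

/-- The monotone stackings: the new vertex is a left child or a right child. -/
def Stacking.IsMonotone (t : Stacking) : Prop :=
  t = .leftChild ∨ t = .rightChild

/-- `StackedTwoTree P x y S E`: the directed graph with vertex set `S` and edge set `E` is a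
directed `2`-tree that has a construction sequence which starts with the base edge from `x` to `y`
and in which the type of every stacking satisfies `P`. (The base edge determines onto which edge
each other vertex is stacked, so the types do not depend on the construction sequence.) -/
inductive StackedTwoTree {V : Type*} (P : Stacking → Prop) (x y : V) :
    Set V → Set (V × V) → Prop
  | base (hxy : x ≠ y) : StackedTwoTree P x y {x, y} {(x, y)}
  | stack {S : Set V} {E : Set (V × V)} (hSE : StackedTwoTree P x y S E)
      {v w : V} (hvw : (v, w) ∈ E) {u : V} (hu : u ∉ S) {t : Stacking} (ht : P t) :
      StackedTwoTree P x y (insert u S) (E ∪ t.newEdges u v w)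

/-- The directed graph with vertex set `S` and edge set `E` is a monotone directed `2`-tree: for
some choice of the base edge, all vertices not on the base edge are monotone. -/
def IsMonotoneTwoTree {V : Type*} (S : Set V) (E : Set (V × V)) : Prop :=
  ∃ x y : V, StackedTwoTree Stacking.IsMonotone x y S E

/-! ### Directed acyclic graphs and stack layouts -/

/-- No directed cycles. (This includes loops and pairs of opposite edges, so every edge of the
underlying simple graph carries exactly one orientation.) -/
def Digraph.IsDAG {V : Type*} (D : Digraph V) : Prop :=
  ∀ v : V, ¬ Relation.TransGen D.Adj v v

/-- A connected outerplanar DAG is block-monotone if each of its blocks, with the orientations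
inherited from `D`, is a monotone directed `2`-tree. -/
def Digraph.IsBlockMonotone {V : Type*} (D : Digraph V) : Prop :=
  D.toSimpleGraphInclusive.Connected ∧ IsOuterplanar D.toSimpleGraphInclusive ∧ D.IsDAG ∧
    ∀ B : D.toSimpleGraphInclusive.Subgraph, IsBlock D.toSimpleGraphInclusive B →
      IsMonotoneTwoTree B.verts {e : V × V | D.Adj e.1 e.2 ∧ B.Adj e.1 e.2}

/-- The edges `ab` and `cd` cross with respect to the vertex ordering `lt`. -/
def EdgesCross {V : Type*} (lt : V → V → Prop) (a b c d : V) : Prop :=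
  (lt a c ∧ lt c b ∧ lt b d) ∨ (lt c a ∧ lt a d ∧ lt d b)

/-- A `k`-stack layout: a topological ordering of the vertices and a colouring of the edges with
`k` colours such that no two edges of the same colour cross. -/
structure Digraph.StackLayout {V : Type*} (D : Digraph V) (k : ℕ) where
  lt : V → V → Prop
  strictTotal : IsStrictTotalOrder V lt
  topological : ∀ a b : V, D.Adj a b → lt a b
  stack : {e : V × V // D.Adj e.1 e.2} → Fin k
  noncrossing : ∀ e f : {e : V × V // D.Adj e.1 e.2}, stack e = stack f →
    ¬ EdgesCross lt e.1.1 e.1.2 f.1.1 f.1.2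

/-! ### Continuous logarithms and theta curves in the plane -/

/-! Eleven stacks already suffice: two copies of a palette of five, plus one extra colour.

Outerplanarity is used only to exclude `K_{2,3}`: two vertices have at most two common neighbours
(`IsOuterplanar.no_three_common_neighbors`). This rests on `theta_curve`. If three arcs from `v` to
`w` all touched the outer face, local logarithms of `(z - v) / (z - w)`, each defined off one arc,
would combine into a global one; a circle around `v` shows that none exists (`no_log_off_pair`).

Within a block, every edge therefore lies in at most two triangles. The 2-tree is laid out along its
construction sequence. Each edge that may still be stacked on owns a slot, a set of coloured chords
reserved for everything that will ever grow there, and slots never conflict with other objects.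
Stacking a vertex consumes one slot and subdivides it into the vertex, its two edges and a slot for
each of them (`IsSlot.exists_right`, `IsSlot.exists_left`). The base edge gets two slots, every
other edge one, since the triangle that created it already accounts for one common neighbour. Five
colours suffice (`IsMonotoneTwoTree.exists_isStackLayoutOn`).

At a cut vertex `c`, the layout of one side is inserted in place of `c` in the layout of the other.
New crossings occur only between an edge ending at `c` and an inserted edge passing over `c`.
Parities in `RootedLayout` give such pairs different colours (`RootedLayout.glue`). Induction on
connected vertex sets finishes the proof. -/

theorem Complex.eqOn_of_exp_comp_eqOn {X : Type*} [TopologicalSpace X] {T : Set X}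
    (hT : IsPreconnected T) {f h : X → ℂ} (hf : ContinuousOn f T) (hh : ContinuousOn h T)
    (hexp : ∀ z ∈ T, Complex.exp (f z) = Complex.exp (h z)) {z₀ : X} (hz₀ : z₀ ∈ T)
    (h₀ : f z₀ = h z₀) : Set.EqOn f h T :=
  Complex.isCoveringMap_exp.eqOn_of_comp_eqOn hT hf hh
    (fun z hz => Subtype.ext (hexp z hz)) hz₀ h₀

/-- Off a path from `v` to `w`, the function `(z - v) / (z - w)` has a continuous logarithm. -/
theorem exists_log_off_path {v w : ℂ} (γ : Path v w) :
    ∃ g : ℂ → ℂ, ContinuousOn g (Set.range γ)ᶜ ∧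
      ∀ z ∉ Set.range γ, Complex.exp (g z) = (z - v) / (z - w) := by
  classical
  let A := {z : ℂ // z ∉ Set.range γ}
  have hw : ∀ z : A, (z : ℂ) - w ≠ 0 := fun z h =>
    z.2 ⟨1, by rw [γ.target]; exact (sub_eq_zero.1 h).symm⟩
  have hne : ∀ p : unitInterval × A, ((p.2 : ℂ) - γ.symm p.1) / (p.2 - w) ≠ 0 := fun p =>
    div_ne_zero (fun h => p.2.2 ⟨unitInterval.symm p.1, (sub_eq_zero.1 h).symm⟩) (hw p.2)
  -- Let the zero of the quotient travel along the path from `w` to `v`. At time `0` the quotient is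
  -- `1`, with logarithm `0`, and the homotopy lifts through the covering `exp`.
  let H : C(unitInterval × A, {z : ℂ // z ≠ 0}) :=
    ⟨fun p => ⟨((p.2 : ℂ) - γ.symm p.1) / (p.2 - w), hne p⟩, by
      refine Continuous.subtype_mk (Continuous.div ?_ ?_ fun p : unitInterval × A => hw p.2) _
      · exact (continuous_subtype_val.comp continuous_snd).sub
          (γ.symm.continuous.comp continuous_fst)
      · exact (continuous_subtype_val.comp continuous_snd).sub continuous_const⟩
  have H0 : ∀ a : A, H (0, a) = ⟨_, Complex.exp_ne_zero ((ContinuousMap.const A (0 : ℂ)) a)⟩ := by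
    intro a
    apply Subtype.ext
    simp [H, div_self (hw a)]
  let K := Complex.isCoveringMap_exp.liftHomotopy H (ContinuousMap.const A 0) H0
  have hK : ∀ a : A, Complex.exp (K (1, a)) = (a - v) / (a - w) := by
    intro a
    have := congrFun (Complex.isCoveringMap_exp.liftHomotopy_lifts H (ContinuousMap.const A 0) H0)
      (1, a)
    have := congrArg Subtype.val this
    exact this.trans (by simp [H])
  refine ⟨fun z => if hz : z ∉ Set.range γ then K (1, ⟨z, hz⟩) else 0, ?_, ?_⟩
  · rw [continuousOn_iff_continuous_domRestrict]
    have : Continuous fun a : A => K (1, a) := by fun_prop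
    refine this.congr fun a => ?_
    have ha : (a : ℂ) ∉ Set.range γ := a.2
    simp only [Set.domRestrict_apply, ha, not_false_eq_true, dite_true]
    rfl
  · intro z hz
    simp only [hz, not_false_eq_true, dite_true]
    exact hK ⟨z, hz⟩

/-- `(z - v) / (z - w)` has no continuous logarithm on the plane without `v` and `w`. -/
theorem no_log_off_pair {v w : ℂ} (hvw : v ≠ w) (G : ℂ → ℂ)
    (hG : ContinuousOn G {v, w}ᶜ)
    (hexp : ∀ z, z ≠ v → z ≠ w → Complex.exp (G z) = (z - v) / (z - w)) : False := by
  have hd : v - w ≠ 0 := sub_ne_zero.2 hvw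
  -- A circle around `v` of half the distance to `w`. Seen from `w`, the factor `q` stays in the
  -- right half-plane, so its principal logarithm is continuous.
  let c : ℝ → ℂ := fun θ => v + (v - w) / 2 * Complex.exp (θ * Complex.I)
  have hc : Continuous c := by fun_prop
  let q : ℝ → ℂ := fun θ => 1 + Complex.exp (θ * Complex.I) / 2
  have hq : Continuous q := by fun_prop
  have hnorm : ∀ θ : ℝ, ‖Complex.exp (θ * Complex.I)‖ = 1 := Complex.norm_exp_ofReal_mul_I
  have hqre : ∀ θ, 0 < (q θ).re := by
    intro θ
    have := Complex.abs_re_le_norm (Complex.exp (θ * Complex.I))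
    rw [hnorm] at this
    have := (abs_le.1 this).1
    have h2 : (q θ).re = 1 + (Complex.exp (θ * Complex.I)).re / 2 := by simp [q]
    rw [h2]; linarith
  have hq0 : ∀ θ, q θ ≠ 0 := fun θ h => by have := hqre θ; rw [h] at this; simp at this
  have hcw : ∀ θ, c θ - w = (v - w) * q θ := fun θ => by simp only [c, q]; ring
  have hcv : ∀ θ, c θ - v = (v - w) / 2 * Complex.exp (θ * Complex.I) := fun θ => by
    simp only [c]; ring
  have hcv' : ∀ θ, c θ ≠ v := fun θ => sub_ne_zero.1 (by
    rw [hcv]; exact mul_ne_zero (div_ne_zero hd two_ne_zero) (Complex.exp_ne_zero _))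
  have hcw' : ∀ θ, c θ ≠ w := fun θ => sub_ne_zero.1 (by rw [hcw]; exact mul_ne_zero hd (hq0 θ))
  -- Since `exp ∘ H` is constant, so is `H`; yet one turn changes it by `-2πi`, because all terms
  -- but the last are periodic.
  let H : ℝ → ℂ := fun θ => G (c θ) + Complex.log (q θ) - θ * Complex.I
  have hH : Continuous H := by
    refine Continuous.sub (Continuous.add ?_ (hq.clog fun θ => Or.inl (hqre θ))) (by fun_prop)
    exact hG.comp_continuous hc fun θ => by simp [hcv', hcw']
  have hexpH : ∀ θ, Complex.exp (H θ) = 1 / 2 := by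
    intro θ
    have h1 := Complex.exp_ne_zero (θ * Complex.I)
    have h2 := hq0 θ
    simp only [H]
    rw [Complex.exp_sub, Complex.exp_add, hexp _ (hcv' θ) (hcw' θ), Complex.exp_log (hq0 θ), hcv,
      hcw]
    field_simp
  have hconst : Set.EqOn H (fun _ => H 0) Set.univ :=
    Complex.eqOn_of_exp_comp_eqOn isPreconnected_univ hH.continuousOn continuousOn_const
      (fun z _ => by rw [hexpH, hexpH]) (Set.mem_univ 0) rfl
  have h2π := hconst (Set.mem_univ (2 * Real.pi))
  have he : Complex.exp ((2 * Real.pi : ℝ) * Complex.I) = Complex.exp ((0 : ℝ) * Complex.I) := by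
    push_cast; rw [Complex.exp_two_pi_mul_I]; simp
  simp only [H, c, q, he] at h2π
  have : (2 * Real.pi : ℂ) * Complex.I = 0 := by
    push_cast at h2π
    linear_combination -h2π
  exact Complex.two_pi_I_ne_zero this

theorem Complex.isPreconnected_norm_gt {R : ℝ} (hR : 0 < R) :
    IsPreconnected {z : ℂ | R < ‖z‖} := by
  have : {z : ℂ | R < ‖z‖} = Complex.exp '' {z : ℂ | Real.log R < z.re} := by
    ext z
    constructor
    · intro hz
      have hz0 : 0 < ‖z‖ := hR.trans hz
      exact ⟨Complex.log z, by
        simpa [Complex.log_re] using Real.log_lt_log hR hz, Complex.exp_log (norm_pos_iff.1 hz0)⟩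
    · rintro ⟨y, hy, rfl⟩
      have := Real.exp_lt_exp.2 hy
      rw [Real.exp_log hR] at this
      simpa [Complex.norm_exp] using this
  rw [this]
  exact (convex_halfSpace_re_gt _).isPreconnected.image _ Complex.continuous_exp.continuousOn

/-- Two logarithms that agree on `O` agree near every point `a` of the closure of `O`. -/
theorem eq_of_mem_closure_of_exp_eq {F O : Set ℂ} (hF : IsClosed F) {f h : ℂ → ℂ}
    (hf : ContinuousOn f Fᶜ) (hh : ContinuousOn h Fᶜ)
    (hexp : ∀ z ∉ F, Complex.exp (f z) = Complex.exp (h z))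
    (hO : ∀ z ∈ O, z ∉ F → f z = h z) {a : ℂ} (ha : a ∉ F) (haO : a ∈ closure O) :
    ∃ ε > 0, Metric.ball a ε ⊆ Fᶜ ∧ Set.EqOn f h (Metric.ball a ε) := by
  obtain ⟨ε, hε, hball⟩ := Metric.isOpen_iff.1 hF.isOpen_compl a ha
  obtain ⟨b, hbO, hb⟩ := Metric.mem_closure_iff.1 haO ε hε
  have hb' : b ∈ Metric.ball a ε := by rwa [Metric.mem_ball, dist_comm]
  exact ⟨ε, hε, hball, Complex.eqOn_of_exp_comp_eqOn (convex_ball a ε).isPreconnected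
    (hf.mono hball) (hh.mono hball) (fun z hz => hexp z (hball hz)) hb' (hO b hbO (hball hb'))⟩

/-- Three arcs from `v` to `w`, otherwise disjoint, cannot all have an interior point `a i` in the
closure of the set `O` of points in unbounded connected subsets of the complement. -/
theorem theta_curve {v w : ℂ} (hvw : v ≠ w) (γ : Fin 3 → Path v w) (a : Fin 3 → ℂ)
    (hdisj : ∀ i j, i ≠ j → Set.range (γ i) ∩ Set.range (γ j) ⊆ {v, w})
    (hconn : ∀ i, ∀ z ∈ Set.range (γ i), z ≠ v → z ≠ w →
      ∃ T ⊆ Set.range (γ i) \ {v, w}, IsPreconnected T ∧ a i ∈ T ∧ z ∈ T)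
    (ha : ∀ i, a i ∈ Set.range (γ i) \ {v, w})
    (O : Set ℂ)
    (hO : ∀ z ∈ O, ∃ C : Set ℂ, IsPreconnected C ∧ z ∈ C ∧ (∀ i, Disjoint C (Set.range (γ i))) ∧
      ¬ Bornology.IsBounded C)
    (haO : ∀ i, a i ∈ closure O) : False := by
  classical
  have hcpt : ∀ i, IsCompact (Set.range (γ i)) := fun i => isCompact_range (γ i).continuous
  have hcl : ∀ i, IsClosed (Set.range (γ i)) := fun i => (hcpt i).isClosed
  have hv : ∀ i, v ∈ Set.range (γ i) := fun i => ⟨0, (γ i).source⟩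
  have hw : ∀ i, w ∈ Set.range (γ i) := fun i => ⟨1, (γ i).target⟩
  obtain ⟨R, hR0, hR⟩ : ∃ R > 0, ∀ i, ∀ z ∈ Set.range (γ i), ‖z‖ ≤ R := by
    have := (isCompact_iUnion hcpt).isBounded.exists_pos_norm_le
    obtain ⟨R, hR0, hR⟩ := this
    exact ⟨R, hR0, fun i z hz => hR z (Set.mem_iUnion.2 ⟨i, hz⟩)⟩
  choose g₀ hg₀ hexp₀ using fun i => exists_log_off_path (γ i)
  set X : Set ℂ := {z | R < ‖z‖} with hX
  have hXoff : ∀ i, ∀ z ∈ X, z ∉ Set.range (γ i) := fun i z hz h => not_le.2 hz (hR i z h)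
  set x₀ : ℂ := ((R + 1 : ℝ) : ℂ)
  have hx₀ : x₀ ∈ X := by
    simp only [hX, x₀, Set.mem_ofPred_eq, Complex.norm_real, Real.norm_eq_abs]
    rw [abs_of_pos (by linarith)]; linarith
  -- The three logarithms are normalised to agree at one far point, hence outside a large disc and
  -- on all of `O`.
  obtain ⟨g, hg, hexp, hgx₀⟩ : ∃ g : Fin 3 → ℂ → ℂ,
      (∀ i, ContinuousOn (g i) (Set.range (γ i))ᶜ) ∧
      (∀ i, ∀ z ∉ Set.range (γ i), Complex.exp (g i z) = (z - v) / (z - w)) ∧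
      ∀ i j, g i x₀ = g j x₀ := by
    refine ⟨fun i z => g₀ i z - g₀ i x₀ + g₀ 0 x₀,
      fun i => ((hg₀ i).sub continuousOn_const).add continuousOn_const, ?_, fun i j => by ring⟩
    intro i z hz
    rw [Complex.exp_add, Complex.exp_sub, hexp₀ i z hz, hexp₀ i x₀ (hXoff i _ hx₀),
      hexp₀ 0 x₀ (hXoff 0 _ hx₀), div_mul_cancel₀]
    rw [← hexp₀ 0 x₀ (hXoff 0 _ hx₀)]; exact Complex.exp_ne_zero _
  have hcont2 : ∀ i j, ContinuousOn (g i) (Set.range (γ i) ∪ Set.range (γ j))ᶜ ∧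
      ContinuousOn (g j) (Set.range (γ i) ∪ Set.range (γ j))ᶜ := fun i j =>
    ⟨(hg i).mono (Set.compl_subset_compl.2 Set.subset_union_left),
      (hg j).mono (Set.compl_subset_compl.2 Set.subset_union_right)⟩
  have hexp2 : ∀ i j, ∀ z ∉ Set.range (γ i) ∪ Set.range (γ j),
      Complex.exp (g i z) = Complex.exp (g j z) := by
    intro i j z hz
    rw [Set.mem_union, not_or] at hz
    rw [hexp i z hz.1, hexp j z hz.2]
  have hagreeX : ∀ i j, Set.EqOn (g i) (g j) X := fun i j =>
    Complex.eqOn_of_exp_comp_eqOn (Complex.isPreconnected_norm_gt hR0)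
      ((hg i).mono (hXoff i)) ((hg j).mono (hXoff j))
      (fun z hz => by rw [hexp i z (hXoff i z hz), hexp j z (hXoff j z hz)]) hx₀ (hgx₀ i j)
  have hagreeO : ∀ i j, ∀ z ∈ O, g i z = g j z := by
    intro i j z hz
    obtain ⟨C, hC, hzC, hCd, hCb⟩ := hO z hz
    have hCoff : ∀ i, ∀ y ∈ C, y ∉ Set.range (γ i) := fun i y hy h =>
      Set.disjoint_left.1 (hCd i) hy h
    obtain ⟨y, hyC, hyX⟩ : ∃ y ∈ C, y ∈ X := by
      by_contra! hcon
      refine hCb ((Metric.isBounded_closedBall (x := (0 : ℂ)) (r := R)).subset fun y hy => ?_)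
      simpa [X] using hcon y hy
    exact Complex.eqOn_of_exp_comp_eqOn hC ((hg i).mono (hCoff i)) ((hg j).mono (hCoff j))
      (fun z hz => by rw [hexp i z (hCoff i z hz), hexp j z (hCoff j z hz)]) hyC
      (hagreeX i j hyX) hzC
  -- The open arc `k` is off the other two arcs and meets the closure of `O` at `a k`. Agreement of
  -- `g i` and `g j` there spreads along the arc by connectedness.
  have hagreeP : ∀ k i j, k ≠ i → k ≠ j → ∀ z ∈ Set.range (γ k), z ≠ v → z ≠ w →
      g i z = g j z := by
    intro k i j hki hkj z hz hzv hzw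
    have hoff : ∀ y ∈ Set.range (γ k) \ {v, w}, y ∉ Set.range (γ i) ∪ Set.range (γ j) := by
      rintro y ⟨hyk, hy⟩ (hyi | hyj)
      · exact hy (hdisj k i hki ⟨hyk, hyi⟩)
      · exact hy (hdisj k j hkj ⟨hyk, hyj⟩)
    obtain ⟨ε, hε, -, heq⟩ := eq_of_mem_closure_of_exp_eq ((hcl i).union (hcl j))
      (hcont2 i j).1 (hcont2 i j).2 (hexp2 i j) (fun z hz _ => hagreeO i j z hz)
      (hoff _ (ha k)) (haO k)
    obtain ⟨T, hTs, hT, haT, hzT⟩ := hconn k z hz hzv hzw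
    exact Complex.eqOn_of_exp_comp_eqOn hT ((hcont2 i j).1.mono fun y hy => hoff y (hTs hy))
      ((hcont2 i j).2.mono fun y hy => hoff y (hTs hy)) (fun y hy => hexp2 i j y (hoff y (hTs hy)))
      haT (heq (Metric.mem_ball_self hε)) hzT
  set U : Fin 3 → Fin 3 → Set ℂ :=
    fun i j => {z | z ∉ Set.range (γ i) ∪ Set.range (γ j) ∧ g i z = g j z} with hU
  have hUopen : ∀ i j, IsOpen (U i j) := by
    intro i j
    rw [Metric.isOpen_iff]
    rintro z ⟨hz, hgz⟩
    obtain ⟨ε, hε, hball, heq⟩ := eq_of_mem_closure_of_exp_eq ((hcl i).union (hcl j))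
      (hcont2 i j).1 (hcont2 i j).2 (hexp2 i j) (O := {z}) (fun y hy _ => by
        rw [Set.mem_singleton_iff.1 hy]; exact hgz) hz (subset_closure rfl)
    exact ⟨ε, hε, fun y hy => ⟨hball hy, heq hy⟩⟩
  -- A majority vote: wherever two of the logarithms are defined and agree, `G` takes their common
  -- value. On arc `k` the other two decide.
  let G : ℂ → ℂ := fun z => if z ∈ U 1 2 then g 2 z else if z ∈ U 0 2 then g 2 z
    else if z ∈ U 0 1 then g 0 z else g 0 z
  have hG12 : Set.EqOn G (g 2) (U 1 2) := fun z hz => by simp only [G, hz, if_true]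
  have hG02 : Set.EqOn G (g 2) (U 0 2) := fun z hz => by simp only [G, hz, if_true, ite_self]
  have hG01 : Set.EqOn G (g 0) (U 0 1) := by
    intro z hz
    simp only [G, ite_self]
    split_ifs with h1 h2
    · exact (hz.2.trans h1.2).symm
    · exact h2.2.symm
    · rfl
  have hcontAt : ∀ i z, z ∉ Set.range (γ i) → ContinuousAt (g i) z := fun i z hz =>
    (hg i).continuousAt ((hcl i).isOpen_compl.mem_nhds hz)
  have hmain : ∀ z, z ≠ v → z ≠ w → ContinuousAt G z ∧ Complex.exp (G z) = (z - v) / (z - w) := by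
    intro z hzv hzw
    have key : ∀ i, z ∉ Set.range (γ i) → (∃ W, IsOpen W ∧ z ∈ W ∧ Set.EqOn G (g i) W) →
        ContinuousAt G z ∧ Complex.exp (G z) = (z - v) / (z - w) := by
      rintro i hi ⟨W, hW, hzW, heq⟩
      refine ⟨(hcontAt i z hi).congr (Filter.eventuallyEq_of_mem (hW.mem_nhds hzW) heq.symm), ?_⟩
      rw [heq hzW, hexp i z hi]
    by_cases h12 : z ∈ U 1 2
    · exact key 2 (fun h => h12.1 (Or.inr h)) ⟨_, hUopen 1 2, h12, hG12⟩
    by_cases h02 : z ∈ U 0 2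
    · exact key 2 (fun h => h02.1 (Or.inr h)) ⟨_, hUopen 0 2, h02, hG02⟩
    by_cases h01 : z ∈ U 0 1
    · exact key 0 (fun h => h01.1 (Or.inl h)) ⟨_, hUopen 0 1, h01, hG01⟩
    have hnot : ∀ k, z ∉ Set.range (γ k) := by
      intro k hk
      have hoff : ∀ i, k ≠ i → z ∉ Set.range (γ i) := fun i hi h => by
        have := hdisj k i hi ⟨hk, h⟩
        simp [hzv, hzw] at this
      fin_cases k
      · exact h12 ⟨fun h => h.elim (hoff 1 (by decide)) (hoff 2 (by decide)),
          hagreeP 0 1 2 (by decide) (by decide) z hk hzv hzw⟩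
      · exact h02 ⟨fun h => h.elim (hoff 0 (by decide)) (hoff 2 (by decide)),
          hagreeP 1 0 2 (by decide) (by decide) z hk hzv hzw⟩
      · exact h01 ⟨fun h => h.elim (hoff 0 (by decide)) (hoff 1 (by decide)),
          hagreeP 2 0 1 (by decide) (by decide) z hk hzv hzw⟩
    -- Off all arcs without any agreement, the three values remain pairwise distinct nearby, so the
    -- default `g 0` is used on a whole neighbourhood.
    have hne : ∀ i j, z ∉ U i j → g i z ≠ g j z := fun i j h h' =>
      h ⟨fun h => h.elim (hnot i) (hnot j), h'⟩
    have hev : ∀ i j, g i z ≠ g j z → ∀ᶠ y in nhds z, g i y ≠ g j y := fun i j h =>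
      (((hcontAt i z (hnot i)).sub (hcontAt j z (hnot j))).eventually_ne (sub_ne_zero.2 h)).mono
        fun y hy => sub_ne_zero.1 hy
    obtain ⟨W, hWG, hW, hzW⟩ := eventually_nhds_iff.1
      ((hev 1 2 (hne 1 2 h12)).and ((hev 0 2 (hne 0 2 h02)).and (hev 0 1 (hne 0 1 h01))))
    refine key 0 (hnot 0) ⟨W, hW, hzW, fun y hy => ?_⟩
    have h1 : y ∉ U 1 2 := fun h => (hWG y hy).1 h.2
    have h2 : y ∉ U 0 2 := fun h => (hWG y hy).2.1 h.2
    simp only [G, h1, h2, if_false, ite_self]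
  refine no_log_off_pair hvw G (fun z hz => ?_) fun z h1 h2 => (hmain z h1 h2).2
  simp only [Set.mem_compl_iff, Set.mem_insert_iff, Set.mem_singleton_iff, not_or] at hz
  exact (hmain z hz.1 hz.2).1.continuousWithinAt

/-- In an outerplanar graph, two vertices have at most two common neighbours. -/
theorem IsOuterplanar.no_three_common_neighbors {V : Type*} {G : SimpleGraph V}
    (hG : IsOuterplanar G) {v w : V} (hvw : v ≠ w) (a : Fin 3 → V) (ha : Function.Injective a)
    (h1 : ∀ i, G.Adj v (a i)) (h2 : ∀ i, G.Adj (a i) w) : False := by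
  obtain ⟨Γ, hΓ⟩ := hG
  let γ : Fin 3 → Path (Γ.pos v) (Γ.pos w) := fun i =>
    (Γ.arc v (a i) (h1 i)).trans (Γ.arc (a i) w (h2 i))
  have hrange : ∀ i, Set.range (γ i) =
      Set.range (Γ.arc v (a i) (h1 i)) ∪ Set.range (Γ.arc (a i) w (h2 i)) := fun i =>
    Path.trans_range _ _
  have hvert : ∀ i u, Γ.pos u ∈ Set.range (γ i) → u = v ∨ u = a i ∨ u = w := by
    intro i u hu
    rw [hrange] at hu
    rcases hu with hu | hu
    · rcases Γ.vertex_on_arc _ _ _ _ hu with h | h <;> simp [h]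
    · rcases Γ.vertex_on_arc _ _ _ _ hu with h | h <;> simp [h]
  have hmem : ∀ i, Γ.pos (a i) ∈ Set.range (γ i) := fun i => by
    rw [hrange]; exact Or.inl ⟨1, Path.target _⟩
  have hoff : ∀ i, Γ.pos (a i) ∉ ({Γ.pos v, Γ.pos w} : Set ℂ) := by
    rintro i (h | h)
    · exact (h1 i).ne (Γ.pos_injective h).symm
    · exact (h2 i).ne (Γ.pos_injective h)
  have hsupp : ∀ i, Set.range (γ i) ⊆ Γ.support := by
    intro i z hz
    rw [hrange] at hz
    rcases hz with hz | hz
    · exact Or.inr ⟨_, _, h1 i, hz⟩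
    · exact Or.inr ⟨_, _, h2 i, hz⟩
  refine theta_curve (fun h => hvw (Γ.pos_injective h)) γ (fun i => Γ.pos (a i)) ?_ ?_
    (fun i => ⟨hmem i, hoff i⟩) Γ.outerFace ?_ fun i => hΓ _
  · rintro i j hij z ⟨hzi, hzj⟩
    have hz : z ∈ Set.range Γ.pos := by
      have hne : a i ≠ a j := fun h => hij (ha h)
      have n1 := (h1 i).ne
      have n2 := (h2 i).ne
      have n3 := (h1 j).ne
      have n4 := (h2 j).ne
      rw [hrange] at hzi hzj
      rcases hzi with hzi | hzi <;> rcases hzj with hzj | hzj <;>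
        exact Γ.arc_inter_arc _ _ _ _ _ _ (by rw [Ne, Sym2.eq_iff]; grind) ⟨hzi, hzj⟩
    obtain ⟨u, rfl⟩ := hz
    have hi := hvert i u hzi
    have hj := hvert j u hzj
    have hne : a i ≠ a j := fun h => hij (ha h)
    have : u = v ∨ u = w := by grind
    rcases this with rfl | rfl <;> simp
  · intro i z hz hzv hzw
    have hz' := hz
    rw [hrange] at hz'
    have himage : ∀ {p q : ℂ} (δ : Path p q) (S : Set unitInterval), IsPreconnected S →
        IsPreconnected (δ '' S) := fun δ S hS => hS.image _ δ.continuous.continuousOn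
    -- Half of the arc, with the pole `v` or `w` left out and `a i` kept, is connected and contains
    -- the point.
    rcases hz' with ⟨t, rfl⟩ | ⟨t, rfl⟩
    · refine ⟨Γ.arc v (a i) (h1 i) '' Set.Ioc 0 1, ?_, himage _ _ Set.ordConnected_Ioc.isPreconnected,
        ⟨1, ⟨zero_lt_one, le_rfl⟩, Path.target _⟩, t, ⟨?_, t.2.2⟩, rfl⟩
      · rintro _ ⟨s, hs, rfl⟩
        refine ⟨by rw [hrange]; exact Or.inl ⟨s, rfl⟩, ?_⟩
        rintro (h | h)
        · exact hs.1.ne' (Γ.arc_injective _ _ (h1 i) (h.trans (Path.source _).symm))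
        · rcases Γ.vertex_on_arc _ _ (h1 i) w ⟨s, h⟩ with h | h
          · exact hvw h.symm
          · exact (h2 i).ne h.symm
      · exact lt_of_le_of_ne t.2.1 fun h => hzv (by
          rw [show t = 0 from h.symm, Path.source])
    · refine ⟨Γ.arc (a i) w (h2 i) '' Set.Ico 0 1, ?_, himage _ _ Set.ordConnected_Ico.isPreconnected,
        ⟨0, ⟨le_rfl, zero_lt_one⟩, Path.source _⟩, t, ⟨t.2.1, ?_⟩, rfl⟩
      · rintro _ ⟨s, hs, rfl⟩
        refine ⟨by rw [hrange]; exact Or.inr ⟨s, rfl⟩, ?_⟩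
        rintro (h | h)
        · rcases Γ.vertex_on_arc _ _ (h2 i) v ⟨s, h⟩ with h | h
          · exact (h1 i).ne h
          · exact hvw h
        · exact hs.2.ne (Γ.arc_injective _ _ (h2 i) (h.trans (Path.target _).symm))
      · exact lt_of_le_of_ne t.2.2 fun h => hzw (by
          rw [show t = 1 from h, Path.target])
  · rintro z ⟨hz, hb⟩
    refine ⟨connectedComponentIn Γ.supportᶜ z, isPreconnected_connectedComponentIn,
      mem_connectedComponentIn hz, fun i => ?_, hb⟩
    rw [Set.disjoint_left]
    exact fun y hy hyi => connectedComponentIn_subset _ _ hy (hsupp i hyi)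

/-! ### Coloured chords and slots -/

/-- A set of coloured chords on the rational line; a vertex is a degenerate chord. -/
abbrev ChordSet := Fin 5 → ℚ → ℚ → Prop

/-- No chord of `A` crosses a chord of `B` of the same colour, and no degenerate chord of `A` is a
degenerate chord of `B`. -/
def ChordsFree (A B : ChordSet) : Prop :=
  ∀ c s t s' t', A c s t → B c s' t' →
    ¬ (s < s' ∧ s' < t ∧ t < t') ∧ ¬ (s' < s ∧ s < t' ∧ t' < t) ∧ ¬ (s = t ∧ s' = t' ∧ s = s')

theorem ChordsFree.symm {A B : ChordSet} (h : ChordsFree A B) : ChordsFree B A :=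
  fun c s t s' t' hB hA => by
    obtain ⟨h1, h2, h3⟩ := h c s' t' s t hA hB
    exact ⟨h2, h1, fun h => h3 ⟨h.2.1, h.1, h.2.2.symm⟩⟩

theorem ChordsFree.mono {A B A' B' : ChordSet} (h : ChordsFree A B) (hA : A' ≤ A) (hB : B' ≤ B) :
    ChordsFree A' B' :=
  fun c s t s' t' h1 h2 => h c s t s' t' (hA c s t h1) (hB c s' t' h2)

/-- The chord set with a single chord. -/
def singleChord (c : Fin 5) (s t : ℚ) : ChordSet := fun c' s' t' => c' = c ∧ s' = s ∧ t' = t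

theorem singleChord_le {c : Fin 5} {s t : ℚ} {A : ChordSet} (h : A c s t) :
    singleChord c s t ≤ A := by
  rintro _ _ _ ⟨rfl, rfl, rfl⟩; exact h

theorem chordsFree_singleChord {c : Fin 5} {s t : ℚ} {A : ChordSet} :
    ChordsFree (singleChord c s t) A ↔ ∀ c' s' t', A c' s' t' → c' = c →
    ¬ (s < s' ∧ s' < t ∧ t < t') ∧ ¬ (s' < s ∧ s < t' ∧ t' < t) ∧
      ¬ (s = t ∧ s' = t' ∧ s = s') := by
  constructor
  · rintro h c' s' t' hA rfl
    exact h _ s t s' t' ⟨rfl, rfl, rfl⟩ hA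
  · rintro h _ _ _ s' t' ⟨rfl, rfl, rfl⟩ hA
    exact h _ s' t' hA rfl

/-- The reflection of a set of chords. -/
def ChordSet.mirror (A : ChordSet) : ChordSet := fun c s t => A c (-t) (-s)

theorem ChordSet.mirror_mirror (A : ChordSet) : A.mirror.mirror = A := by
  funext c _ _; simp [ChordSet.mirror]

theorem ChordSet.mirror_mono {A B : ChordSet} (h : A ≤ B) : A.mirror ≤ B.mirror :=
  fun c _ _ hA => h c _ _ hA

theorem ChordSet.mirror_singleChord (c : Fin 5) (s t : ℚ) :
    (singleChord c s t).mirror = singleChord c (-t) (-s) := by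
  funext c' s' t'
  simp only [ChordSet.mirror, singleChord, eq_iff_iff]
  constructor <;> rintro ⟨h1, h2, h3⟩ <;> exact ⟨h1, by linarith, by linarith⟩

theorem ChordsFree.mirror {A B : ChordSet} (h : ChordsFree A B) :
    ChordsFree A.mirror B.mirror := by
  intro c s t s' t' hA hB
  obtain ⟨h1, h2, h3⟩ := h c _ _ _ _ hA hB
  refine ⟨fun h => h2 ?_, fun h => h1 ?_, fun h => h3 ?_⟩
  · exact ⟨by linarith, by linarith, by linarith⟩
  · exact ⟨by linarith, by linarith, by linarith⟩
  · exact ⟨by linarith, by linarith, by linarith⟩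

/-- The chords reserved for a chain edge with left end `e`, right end `f` and colour `k`. There are
zones `(a₁, a₂)`, `(a₃, a₄)` around `e` with colours `p₁, p₂` available across `e`, and zones
`(b₁, b₂)`, `(b₃, b₄)` around `f` with colours `q₁, q₂` available across `f`. -/
inductive ChainPot (k p₁ p₂ q₁ q₂ : Fin 5) (e f a₁ a₂ a₃ a₄ b₁ b₂ b₃ b₄ : ℚ) : ChordSet
  | chain {s t} (hs : s = e ∨ a₁ < s ∧ s < a₂) (ht : t = f ∨ b₃ < t ∧ t < b₄) :
      ChainPot k p₁ p₂ q₁ q₂ e f a₁ a₂ a₃ a₄ b₁ b₂ b₃ b₄ k s t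
  | starEL {s} (h₁ : a₁ < s) (h₂ : s < a₂) : ChainPot _ _ _ _ _ _ _ _ _ _ _ _ _ _ _ 0 s e
  | starER {s} (h₁ : a₃ < s) (h₂ : s < a₄) : ChainPot _ _ _ _ _ _ _ _ _ _ _ _ _ _ _ 0 e s
  | starFL {s} (h₁ : b₁ < s) (h₂ : s < b₂) : ChainPot _ _ _ _ _ _ _ _ _ _ _ _ _ _ _ 0 s f
  | starFR {s} (h₁ : b₃ < s) (h₂ : s < b₄) : ChainPot _ _ _ _ _ _ _ _ _ _ _ _ _ _ _ 0 f s
  | acrossE {c s t} (hc : c = p₁ ∨ c = p₂) (h₁ : a₁ < s) (h₂ : s < a₂) (h₃ : a₃ < t) (h₄ : t < a₄) :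
      ChainPot _ _ _ _ _ _ _ _ _ _ _ _ _ _ _ c s t
  | acrossF {c s t} (hc : c = q₁ ∨ c = q₂) (h₁ : b₁ < s) (h₂ : s < b₂) (h₃ : b₃ < t) (h₄ : t < b₄) :
      ChainPot _ _ _ _ _ _ _ _ _ _ _ _ _ _ _ c s t
  | zoneEL {c s t} (h₁ : a₁ < s) (h₂ : s < a₂) (h₃ : a₁ < t) (h₄ : t < a₂) :
      ChainPot _ _ _ _ _ _ _ _ _ _ _ _ _ _ _ c s t
  | zoneER {c s t} (h₁ : a₃ < s) (h₂ : s < a₄) (h₃ : a₃ < t) (h₄ : t < a₄) :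
      ChainPot _ _ _ _ _ _ _ _ _ _ _ _ _ _ _ c s t
  | zoneFL {c s t} (h₁ : b₁ < s) (h₂ : s < b₂) (h₃ : b₁ < t) (h₄ : t < b₂) :
      ChainPot _ _ _ _ _ _ _ _ _ _ _ _ _ _ _ c s t
  | zoneFR {c s t} (h₁ : b₃ < s) (h₂ : s < b₄) (h₃ : b₃ < t) (h₄ : t < b₄) :
      ChainPot _ _ _ _ _ _ _ _ _ _ _ _ _ _ _ c s t

/-- The chords reserved for a star edge with centre `d` and other end `g`. There are outer zones
`(l₁, l₂)`, `(r₁, r₂)` around `d`, with the colours `c₁` (to be used next) and `c₂` available across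
`d`, and zones `(a₁, a₂)`, `(a₃, a₄)` around `g` with colours `p₁, p₂` available across `g`. -/
inductive StarPot (c₁ c₂ p₁ p₂ : Fin 5) (d g l₁ l₂ a₁ a₂ a₃ a₄ r₁ r₂ : ℚ) : ChordSet
  | starDL {s} (h₁ : l₁ < s) (h₂ : s < l₂) : StarPot c₁ c₂ p₁ p₂ d g l₁ l₂ a₁ a₂ a₃ a₄ r₁ r₂ 0 s d
  | starDR {s} (h₁ : r₁ < s) (h₂ : s < r₂) : StarPot _ _ _ _ _ _ _ _ _ _ _ _ _ _ 0 d s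
  | starGL {s} (h₁ : a₁ < s) (h₂ : s < a₂) : StarPot _ _ _ _ _ _ _ _ _ _ _ _ _ _ 0 s g
  | starGR {s} (h₁ : a₃ < s) (h₂ : s < a₄) : StarPot _ _ _ _ _ _ _ _ _ _ _ _ _ _ 0 g s
  | nextR {s t} (hs : s = g ∨ a₁ < s ∧ s < a₂) (h₁ : r₁ < t) (h₂ : t < r₂) :
      StarPot _ _ _ _ _ _ _ _ _ _ _ _ _ _ c₁ s t
  | nextL {s t} (h₁ : l₁ < s) (h₂ : s < l₂) (ht : t = g ∨ a₃ < t ∧ t < a₄) :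
      StarPot _ _ _ _ _ _ _ _ _ _ _ _ _ _ c₁ s t
  | acrossD {c s t} (hc : c = c₁ ∨ c = c₂) (h₁ : l₁ < s) (h₂ : s < l₂) (h₃ : r₁ < t) (h₄ : t < r₂) :
      StarPot _ _ _ _ _ _ _ _ _ _ _ _ _ _ c s t
  | acrossG {c s t} (hc : c = p₁ ∨ c = p₂) (h₁ : a₁ < s) (h₂ : s < a₂) (h₃ : a₃ < t) (h₄ : t < a₄) :
      StarPot _ _ _ _ _ _ _ _ _ _ _ _ _ _ c s t
  | zoneL {c s t} (h₁ : l₁ < s) (h₂ : s < l₂) (h₃ : l₁ < t) (h₄ : t < l₂) :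
      StarPot _ _ _ _ _ _ _ _ _ _ _ _ _ _ c s t
  | zoneGL {c s t} (h₁ : a₁ < s) (h₂ : s < a₂) (h₃ : a₁ < t) (h₄ : t < a₂) :
      StarPot _ _ _ _ _ _ _ _ _ _ _ _ _ _ c s t
  | zoneGR {c s t} (h₁ : a₃ < s) (h₂ : s < a₄) (h₃ : a₃ < t) (h₄ : t < a₄) :
      StarPot _ _ _ _ _ _ _ _ _ _ _ _ _ _ c s t
  | zoneR {c s t} (h₁ : r₁ < s) (h₂ : s < r₂) (h₃ : r₁ < t) (h₄ : t < r₂) :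
      StarPot _ _ _ _ _ _ _ _ _ _ _ _ _ _ c s t

/-- The colour constraints for a chain edge. -/
structure ChainColors (k p₁ p₂ q₁ q₂ : Fin 5) : Prop where
  k0 : k ≠ 0
  p : p₁ ≠ 0 ∧ p₂ ≠ 0 ∧ p₁ ≠ p₂ ∧ k ≠ p₁ ∧ k ≠ p₂
  q : q₁ ≠ 0 ∧ q₂ ≠ 0 ∧ q₁ ≠ q₂ ∧ k ≠ q₁ ∧ k ≠ q₂

/-- The colour constraints for a star edge. -/
structure StarColors (c₁ c₂ p₁ p₂ : Fin 5) : Prop where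
  c : c₁ ≠ 0 ∧ c₂ ≠ 0 ∧ c₁ ≠ c₂
  p : p₁ ≠ 0 ∧ p₂ ≠ 0 ∧ p₁ ≠ p₂ ∧ c₁ ≠ p₁ ∧ c₁ ≠ p₂

/-- The zones of a chain edge, from left to right. -/
structure ChainOrder (e f a₁ a₂ a₃ a₄ b₁ b₂ b₃ b₄ : ℚ) : Prop where
  a₁₂ : a₁ < a₂
  a₂e : a₂ < e
  ea₃ : e < a₃
  a₃₄ : a₃ < a₄
  ab : a₄ < b₁
  b₁₂ : b₁ < b₂
  b₂f : b₂ < f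
  fb₃ : f < b₃
  b₃₄ : b₃ < b₄

/-- The zones of a star edge, from left to right. -/
structure StarOrder (d g l₁ l₂ a₁ a₂ a₃ a₄ r₁ r₂ : ℚ) : Prop where
  l₁₂ : l₁ < l₂
  la : l₂ < a₁
  a₁₂ : a₁ < a₂
  a₂g : a₂ < g
  ga₃ : g < a₃
  a₃₄ : a₃ < a₄
  ar : a₄ < r₁
  r₁₂ : r₁ < r₂
  d : l₂ < d ∧ d < a₁ ∨ a₄ < d ∧ d < r₁

/-- The two slots created by stacking on a chain edge. Both use `q₁, q₂` across `x`, but the `y`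
zones lie inside the `z` zones, so these chords nest. The chain colour `k` differs from every colour
the star slot uses between zones, and chords inside a single zone are harmless. -/
theorem chordsFree_chainPot_starPot_of_chain {k p₁ p₂ q₁ q₂ c₁ c₂ : Fin 5}
    {e f a₁ a₂ a₃ a₄ b₁ b₂ x y₁ y₂ y₃ y₄ z₁ z₂ z₃ z₄ r₁ r₂ : ℚ}
    (hk : ChainColors k p₁ p₂ q₁ q₂) (hc : StarColors c₁ c₂ q₁ q₂) (hk1 : k ≠ c₁) (hk2 : k ≠ c₂)
    (hK : ChainOrder e x a₁ a₂ a₃ a₄ y₁ y₂ y₃ y₄)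
    (hS : StarOrder f x b₁ b₂ z₁ z₂ z₃ z₄ r₁ r₂)
    (hab : a₄ < b₁) (hf : b₂ < f) (hfz : f < z₁)
    (hzy : z₂ < y₁) (hyz : y₄ < z₃) :
    ChordsFree (ChainPot k p₁ p₂ q₁ q₂ e x a₁ a₂ a₃ a₄ y₁ y₂ y₃ y₄)
      (StarPot c₁ c₂ q₁ q₂ f x b₁ b₂ z₁ z₂ z₃ z₄ r₁ r₂) := by
  obtain ⟨k0, ⟨kp1, kp2, kp3, kp4, kp5⟩, kq1, kq2, kq3, kq4, kq5⟩ := hk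
  obtain ⟨⟨cc1, cc2, cc3⟩, cp1, cp2, cp3, cp4, cp5⟩ := hc
  obtain ⟨hK1, hK2, hK3, hK4, hK5, hK6, hK7, hK8, hK9⟩ := hK
  obtain ⟨hS1, hS2, hS3, hS4, hS5, hS6, hS7, hS8, hS9⟩ := hS
  clear hS9
  intro c s t s' t' hA hB
  cases hA <;> cases hB <;> grind

/-- The two slots created by stacking on a star edge. The new chain uses `c₁`, so the star must
continue with `c₂`. It may still keep `c₁` across `d`, as those chords run between the outer zones
and enclose the whole chain slot. -/
theorem chordsFree_chainPot_starPot_of_star {c₁ c₂ p₁ p₂ q₁ q₂ : Fin 5}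
    {d g l₁ l₂ a₁ a₂ a₃ a₄ x y₁ y₂ y₃ y₄ z₁ z₂ z₃ z₄ r₁ r₂ : ℚ}
    (hk : ChainColors c₁ p₁ p₂ q₁ q₂) (hc : StarColors c₂ c₁ q₁ q₂)
    (hK : ChainOrder g x a₁ a₂ a₃ a₄ y₁ y₂ y₃ y₄)
    (hS : StarOrder d x l₁ l₂ z₁ z₂ z₃ z₄ r₁ r₂)
    (hla : l₂ < a₁) (haz : a₄ < z₁) (hd : d < a₁ ∨ a₄ < d) (hdz : d < z₁)
    (hzy : z₂ < y₁) (hyz : y₄ < z₃) :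
    ChordsFree (ChainPot c₁ p₁ p₂ q₁ q₂ g x a₁ a₂ a₃ a₄ y₁ y₂ y₃ y₄)
      (StarPot c₂ c₁ q₁ q₂ d x l₁ l₂ z₁ z₂ z₃ z₄ r₁ r₂) := by
  obtain ⟨k0, ⟨kp1, kp2, kp3, kp4, kp5⟩, kq1, kq2, kq3, kq4, kq5⟩ := hk
  obtain ⟨⟨cc1, cc2, cc3⟩, cp1, cp2, cp3, cp4, cp5⟩ := hc
  obtain ⟨hK1, hK2, hK3, hK4, hK5, hK6, hK7, hK8, hK9⟩ := hK
  obtain ⟨hS1, hS2, hS3, hS4, hS5, hS6, hS7, hS8, hS9⟩ := hS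
  clear hS9
  intro c s t s' t' hA hB
  cases hA <;> cases hB <;> grind

theorem ChainPot.le_mirror {k p₁ p₂ q₁ q₂ : Fin 5} {e f a₁ a₂ a₃ a₄ b₁ b₂ b₃ b₄ : ℚ} :
    ChainPot k q₁ q₂ p₁ p₂ (-f) (-e) (-b₄) (-b₃) (-b₂) (-b₁) (-a₄) (-a₃) (-a₂) (-a₁) ≤
      (ChainPot k p₁ p₂ q₁ q₂ e f a₁ a₂ a₃ a₄ b₁ b₂ b₃ b₄ : ChordSet).mirror := by
  intro c s t h
  cases h <;> simp only [ChordSet.mirror, neg_neg]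
  · exact .chain (by grind) (by grind)
  · exact .starFR (by grind) (by grind)
  · exact .starFL (by grind) (by grind)
  · exact .starER (by grind) (by grind)
  · exact .starEL (by grind) (by grind)
  · exact .acrossF (by grind) (by grind) (by grind) (by grind) (by grind)
  · exact .acrossE (by grind) (by grind) (by grind) (by grind) (by grind)
  · exact .zoneFR (by grind) (by grind) (by grind) (by grind)
  · exact .zoneFL (by grind) (by grind) (by grind) (by grind)
  · exact .zoneER (by grind) (by grind) (by grind) (by grind)
  · exact .zoneEL (by grind) (by grind) (by grind) (by grind)

theorem StarPot.le_mirror {c₁ c₂ p₁ p₂ : Fin 5} {d g l₁ l₂ a₁ a₂ a₃ a₄ r₁ r₂ : ℚ} :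
    StarPot c₁ c₂ p₁ p₂ (-d) (-g) (-r₂) (-r₁) (-a₄) (-a₃) (-a₂) (-a₁) (-l₂) (-l₁) ≤
      (StarPot c₁ c₂ p₁ p₂ d g l₁ l₂ a₁ a₂ a₃ a₄ r₁ r₂ : ChordSet).mirror := by
  intro c s t h
  cases h <;> simp only [ChordSet.mirror, neg_neg]
  · exact .starDR (by grind) (by grind)
  · exact .starDL (by grind) (by grind)
  · exact .starGR (by grind) (by grind)
  · exact .starGL (by grind) (by grind)
  · exact .nextL (by grind) (by grind) (by grind)
  · exact .nextR (by grind) (by grind) (by grind)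
  · exact .acrossD (by grind) (by grind) (by grind) (by grind) (by grind)
  · exact .acrossG (by grind) (by grind) (by grind) (by grind) (by grind)
  · exact .zoneR (by grind) (by grind) (by grind) (by grind)
  · exact .zoneGR (by grind) (by grind) (by grind) (by grind)
  · exact .zoneGL (by grind) (by grind) (by grind) (by grind)
  · exact .zoneL (by grind) (by grind) (by grind) (by grind)

/-- `Z` contains the chords reserved for an edge between the positions `p < q`. -/
inductive IsSlot : ℚ → ℚ → ChordSet → Prop
  | chain {k p₁ p₂ q₁ q₂ e f a₁ a₂ a₃ a₄ b₁ b₂ b₃ b₄ Z} (hc : ChainColors k p₁ p₂ q₁ q₂)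
      (ho : ChainOrder e f a₁ a₂ a₃ a₄ b₁ b₂ b₃ b₄)
      (hZ : ChainPot k p₁ p₂ q₁ q₂ e f a₁ a₂ a₃ a₄ b₁ b₂ b₃ b₄ ≤ Z) : IsSlot e f Z
  | starLeft {c₁ c₂ p₁ p₂ d g l₁ l₂ a₁ a₂ a₃ a₄ r₁ r₂ Z} (hc : StarColors c₁ c₂ p₁ p₂)
      (ho : StarOrder d g l₁ l₂ a₁ a₂ a₃ a₄ r₁ r₂)
      (hZ : StarPot c₁ c₂ p₁ p₂ d g l₁ l₂ a₁ a₂ a₃ a₄ r₁ r₂ ≤ Z) : IsSlot d g Z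
  | starRight {c₁ c₂ p₁ p₂ d g l₁ l₂ a₁ a₂ a₃ a₄ r₁ r₂ Z} (hc : StarColors c₁ c₂ p₁ p₂)
      (ho : StarOrder d g l₁ l₂ a₁ a₂ a₃ a₄ r₁ r₂)
      (hZ : StarPot c₁ c₂ p₁ p₂ d g l₁ l₂ a₁ a₂ a₃ a₄ r₁ r₂ ≤ Z) : IsSlot g d Z

/-- Reflection reverses edge directions; it reduces stacking on the left to stacking on the right.
This is why a star edge may have its centre at either end. -/
theorem IsSlot.mirror {p q : ℚ} {Z : ChordSet} (h : IsSlot p q Z) :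
    IsSlot (-q) (-p) Z.mirror := by
  have hord : ∀ {d g l₁ l₂ a₁ a₂ a₃ a₄ r₁ r₂ : ℚ}, StarOrder d g l₁ l₂ a₁ a₂ a₃ a₄ r₁ r₂ →
      StarOrder (-d) (-g) (-r₂) (-r₁) (-a₄) (-a₃) (-a₂) (-a₁) (-l₂) (-l₁) := by
    rintro d g l₁ l₂ a₁ a₂ a₃ a₄ r₁ r₂ ⟨h1, h2, h3, h4, h5, h6, h7, h8, h9⟩
    constructor <;> grind
  cases h with
  | chain hc ho hZ =>
    obtain ⟨h1, h2, h3, h4, h5, h6, h7, h8, h9⟩ := ho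
    refine .chain ⟨hc.k0, hc.q, hc.p⟩ ?_
      (le_trans ChainPot.le_mirror (ChordSet.mirror_mono hZ))
    constructor <;> linarith
  | starLeft hc ho hZ =>
    exact .starRight hc (hord ho) (le_trans StarPot.le_mirror (ChordSet.mirror_mono hZ))
  | starRight hc ho hZ =>
    exact .starLeft hc (hord ho) (le_trans StarPot.le_mirror (ChordSet.mirror_mono hZ))

/-- The slot `Z` accommodates a new vertex at `x`, two edges with chord sets `A` and `B`, and new
slots `Z₁` and `Z₂` for these edges. -/
structure SplitsAt (Z : ChordSet) (x : ℚ) (A B Z₁ Z₂ : ChordSet) : Prop where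
  le_x : singleChord 0 x x ≤ Z
  le_A : A ≤ Z
  le_B : B ≤ Z
  le_Z₁ : Z₁ ≤ Z
  le_Z₂ : Z₂ ≤ Z
  x_A : ChordsFree (singleChord 0 x x) A
  x_B : ChordsFree (singleChord 0 x x) B
  x_Z₁ : ChordsFree (singleChord 0 x x) Z₁
  x_Z₂ : ChordsFree (singleChord 0 x x) Z₂
  A_B : ChordsFree A B
  A_Z₁ : ChordsFree A Z₁
  A_Z₂ : ChordsFree A Z₂
  B_Z₁ : ChordsFree B Z₁
  B_Z₂ : ChordsFree B Z₂
  Z₁_Z₂ : ChordsFree Z₁ Z₂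

theorem SplitsAt.swap {Z : ChordSet} {x : ℚ} {A B Z₁ Z₂ : ChordSet} (h : SplitsAt Z x A B Z₁ Z₂) :
    SplitsAt Z x B A Z₂ Z₁ :=
  ⟨h.le_x, h.le_B, h.le_A, h.le_Z₂, h.le_Z₁, h.x_B, h.x_A, h.x_Z₂, h.x_Z₁, h.A_B.symm, h.B_Z₂,
    h.B_Z₁, h.A_Z₂, h.A_Z₁, h.Z₁_Z₂.symm⟩

theorem SplitsAt.mono {Z Z' : ChordSet} {x : ℚ} {A B Z₁ Z₂ : ChordSet}
    (h : SplitsAt Z x A B Z₁ Z₂) (hZ : Z ≤ Z') : SplitsAt Z' x A B Z₁ Z₂ :=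
  { h with
    le_x := h.le_x.trans hZ
    le_A := h.le_A.trans hZ
    le_B := h.le_B.trans hZ
    le_Z₁ := h.le_Z₁.trans hZ
    le_Z₂ := h.le_Z₂.trans hZ }

theorem SplitsAt.mirror {Z : ChordSet} {x : ℚ} {A B Z₁ Z₂ : ChordSet}
    (h : SplitsAt Z x A B Z₁ Z₂) :
    SplitsAt Z.mirror (-x) A.mirror B.mirror Z₁.mirror Z₂.mirror := by
  have hx : singleChord 0 (-x) (-x) = (singleChord 0 x x).mirror :=
    (ChordSet.mirror_singleChord _ _ _).symm
  constructor
  all_goals try rw [hx]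
  · exact ChordSet.mirror_mono h.le_x
  · exact ChordSet.mirror_mono h.le_A
  · exact ChordSet.mirror_mono h.le_B
  · exact ChordSet.mirror_mono h.le_Z₁
  · exact ChordSet.mirror_mono h.le_Z₂
  · exact h.x_A.mirror
  · exact h.x_B.mirror
  · exact h.x_Z₁.mirror
  · exact h.x_Z₂.mirror
  · exact h.A_B.mirror
  · exact h.A_Z₁.mirror
  · exact h.A_Z₂.mirror
  · exact h.B_Z₁.mirror
  · exact h.B_Z₂.mirror
  · exact h.Z₁_Z₂.mirror

/-- Ten points in increasing order inside an interval. -/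
theorem exists_zone_points {u v : ℚ} (h : u < v) : ∃ z₁ z₂ y₁ y₂ x y₃ y₄ z₃ z₄ r : ℚ,
    u < z₁ ∧ z₁ < z₂ ∧ z₂ < y₁ ∧ y₁ < y₂ ∧ y₂ < x ∧ x < y₃ ∧ y₃ < y₄ ∧ y₄ < z₃ ∧ z₃ < z₄ ∧
      z₄ < r ∧ r < v :=
  ⟨u + (v - u) * (1 / 11), u + (v - u) * (2 / 11), u + (v - u) * (3 / 11), u + (v - u) * (4 / 11),
    u + (v - u) * (5 / 11), u + (v - u) * (6 / 11), u + (v - u) * (7 / 11), u + (v - u) * (8 / 11),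
    u + (v - u) * (9 / 11), u + (v - u) * (10 / 11), by linarith, by linarith, by linarith,
    by linarith, by linarith, by linarith, by linarith, by linarith, by linarith, by linarith,
    by linarith⟩

/-- The reason for five colours: `0` is kept for star edges, and two of the other four may be
forbidden. -/
theorem exists_two_colors (k c : Fin 5) : ∃ q₁ q₂ : Fin 5, q₁ ≠ 0 ∧ q₂ ≠ 0 ∧ q₁ ≠ q₂ ∧
    k ≠ q₁ ∧ k ≠ q₂ ∧ c ≠ q₁ ∧ c ≠ q₂ := by
  revert k c; decide

/-- The new vertex goes into the zone right of `f`. The long edge from `e` continues the chain in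
colour `k`; the short edge from `f` opens a star centred at `f`, which inherits the colours `c₁, c₂`
that were available across `f`. Fresh zones around `x` are cut out of the old zone. -/
theorem splitsAt_chainPot {k p₁ p₂ c₁ c₂ : Fin 5} {e f a₁ a₂ a₃ a₄ b₁ b₂ b₃ b₄ : ℚ}
    (hc : ChainColors k p₁ p₂ c₁ c₂) (ho : ChainOrder e f a₁ a₂ a₃ a₄ b₁ b₂ b₃ b₄) :
    ∃ (x : ℚ) (Z₁ Z₂ : ChordSet), f < x ∧ IsSlot e x Z₁ ∧ IsSlot f x Z₂ ∧
      SplitsAt (ChainPot k p₁ p₂ c₁ c₂ e f a₁ a₂ a₃ a₄ b₁ b₂ b₃ b₄) x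
        (singleChord k e x) (singleChord 0 f x) Z₁ Z₂ := by
  obtain ⟨q₁, q₂, q10, q20, q12, kq1, kq2, cq1, cq2⟩ := exists_two_colors k c₁
  obtain ⟨z₁, z₂, y₁, y₂, x, y₃, y₄, z₃, z₄, r, h1, h2, h3, h4, h5, h6, h7, h8, h9, h10, h11⟩ :=
    exists_zone_points ho.b₃₄
  have hK : ChainColors k p₁ p₂ q₁ q₂ := ⟨hc.k0, hc.p, q10, q20, q12, kq1, kq2⟩
  have hS : StarColors c₁ c₂ q₁ q₂ :=
    ⟨⟨hc.q.1, hc.q.2.1, hc.q.2.2.1⟩, q10, q20, q12, cq1, cq2⟩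
  obtain ⟨o1, o2, o3, o4, o5, o6, o7, o8, o9⟩ := ho
  have hKo : ChainOrder e x a₁ a₂ a₃ a₄ y₁ y₂ y₃ y₄ := by constructor <;> linarith
  have hSo : StarOrder f x b₁ b₂ z₁ z₂ z₃ z₄ r b₄ := by
    constructor
    case d => exact Or.inl ⟨by linarith, by linarith⟩
    all_goals linarith
  have hfree := chordsFree_chainPot_starPot_of_chain hK hS hc.q.2.2.2.1 hc.q.2.2.2.2 hKo hSo o5 o7
    (by linarith) h3 h8
  refine ⟨x, _, _, by linarith, .chain hK hKo le_rfl, .starLeft hS hSo le_rfl, ?_⟩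
  obtain ⟨k0, ⟨kp1, kp2, kp3, kp4, kp5⟩, kq1, kq2, kq3, kq4, kq5⟩ := hc
  constructor
  case Z₁_Z₂ => exact hfree
  case le_x => exact singleChord_le (.zoneFR (by linarith) (by linarith) (by linarith) (by linarith))
  case le_A => exact singleChord_le (.chain (Or.inl rfl) (Or.inr ⟨by linarith, by linarith⟩))
  case le_B => exact singleChord_le (.starFR (by linarith) (by linarith))
  case le_Z₁ =>
    intro c s t h
    cases h with
    | chain hs ht => exact .chain hs (by grind)
    | starEL => exact .starEL ‹_› ‹_›
    | starER => exact .starER ‹_› ‹_›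
    | starFL => exact .zoneFR (by grind) (by grind) (by grind) (by grind)
    | starFR => exact .zoneFR (by grind) (by grind) (by grind) (by grind)
    | acrossE => exact .acrossE ‹_› ‹_› ‹_› ‹_› ‹_›
    | acrossF => exact .zoneFR (by grind) (by grind) (by grind) (by grind)
    | zoneEL => exact .zoneEL ‹_› ‹_› ‹_› ‹_›
    | zoneER => exact .zoneER ‹_› ‹_› ‹_› ‹_›
    | zoneFL => exact .zoneFR (by grind) (by grind) (by grind) (by grind)
    | zoneFR => exact .zoneFR (by grind) (by grind) (by grind) (by grind)
  case le_Z₂ =>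
    intro c s t h
    cases h with
    | starDL => exact .starFL ‹_› ‹_›
    | starDR => exact .starFR (by grind) (by grind)
    | starGL => exact .zoneFR (by grind) (by grind) (by grind) (by grind)
    | starGR => exact .zoneFR (by grind) (by grind) (by grind) (by grind)
    | nextR => exact .zoneFR (by grind) (by grind) (by grind) (by grind)
    | nextL => exact .acrossF (by grind) (by grind) (by grind) (by grind) (by grind)
    | acrossD => exact .acrossF (by grind) (by grind) (by grind) (by grind) (by grind)
    | acrossG => exact .zoneFR (by grind) (by grind) (by grind) (by grind)
    | zoneL => exact .zoneFL ‹_› ‹_› ‹_› ‹_›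
    | zoneGL => exact .zoneFR (by grind) (by grind) (by grind) (by grind)
    | zoneGR => exact .zoneFR (by grind) (by grind) (by grind) (by grind)
    | zoneR => exact .zoneFR (by grind) (by grind) (by grind) (by grind)
  case x_A => rw [chordsFree_singleChord]; rintro c' s t ⟨-, rfl, rfl⟩ -; grind
  case x_B => rw [chordsFree_singleChord]; rintro c' s t ⟨-, rfl, rfl⟩ -; grind
  case A_B => rw [chordsFree_singleChord]; rintro c' s t ⟨h, rfl, rfl⟩ h'; exact absurd (h'.symm.trans h) k0
  all_goals
    rw [chordsFree_singleChord]
    intro c' s t h hc'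
    cases h <;> grind

/-- The new vertex goes into the right outer zone. The edge from the centre `d` extends the star,
with `c₁` and `c₂` exchanged so that the next chain edges alternate; the edge from `g` starts a
chain of colour `c₁`, keeping the zones around `g`. -/
theorem splitsAt_starPot {c₁ c₂ p₁ p₂ : Fin 5} {d g l₁ l₂ a₁ a₂ a₃ a₄ r₁ r₂ : ℚ}
    (hc : StarColors c₁ c₂ p₁ p₂) (ho : StarOrder d g l₁ l₂ a₁ a₂ a₃ a₄ r₁ r₂) :
    ∃ (x : ℚ) (Z₁ Z₂ : ChordSet), d < x ∧ g < x ∧ IsSlot g x Z₁ ∧ IsSlot d x Z₂ ∧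
      SplitsAt (StarPot c₁ c₂ p₁ p₂ d g l₁ l₂ a₁ a₂ a₃ a₄ r₁ r₂) x
        (singleChord c₁ g x) (singleChord 0 d x) Z₁ Z₂ := by
  obtain ⟨q₁, q₂, q10, q20, q12, c1q1, c1q2, c2q1, c2q2⟩ := exists_two_colors c₁ c₂
  obtain ⟨z₁, z₂, y₁, y₂, x, y₃, y₄, z₃, z₄, r, h1, h2, h3, h4, h5, h6, h7, h8, h9, h10, h11⟩ :=
    exists_zone_points ho.r₁₂
  have hK : ChainColors c₁ p₁ p₂ q₁ q₂ := ⟨hc.c.1, hc.p, q10, q20, q12, c1q1, c1q2⟩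
  have hS : StarColors c₂ c₁ q₁ q₂ :=
    ⟨⟨hc.c.2.1, hc.c.1, hc.c.2.2.symm⟩, q10, q20, q12, c2q1, c2q2⟩
  obtain ⟨o1, o2, o3, o4, o5, o6, o7, o8, o9⟩ := ho
  have hd1 : d < a₁ ∨ a₄ < d := o9.imp And.right And.left
  have hd2 : l₂ < d := by grind
  have hd3 : d < r₁ := by grind
  have hKo : ChainOrder g x a₁ a₂ a₃ a₄ y₁ y₂ y₃ y₄ := by constructor <;> linarith
  have hSo : StarOrder d x l₁ l₂ z₁ z₂ z₃ z₄ r r₂ := by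
    constructor
    case d => exact Or.inl ⟨by linarith, by linarith⟩
    all_goals linarith
  have hfree := chordsFree_chainPot_starPot_of_star hK hS hKo hSo o2 (by linarith) hd1
    (by linarith) h3 h8
  refine ⟨x, _, _, by linarith, by linarith, .chain hK hKo le_rfl, .starLeft hS hSo le_rfl, ?_⟩
  obtain ⟨⟨c10, c20, c12⟩, hp1, hp2, hp3, hp4, hp5⟩ := hc
  clear o9
  constructor
  case Z₁_Z₂ => exact hfree
  case le_x => exact singleChord_le (.zoneR (by linarith) (by linarith) (by linarith) (by linarith))
  case le_A => exact singleChord_le (.nextR (Or.inl rfl) (by linarith) (by linarith))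
  case le_B => exact singleChord_le (.starDR (by linarith) (by linarith))
  case le_Z₁ =>
    intro c s t h
    cases h with
    | chain hs ht => exact .nextR hs (by grind) (by grind)
    | starEL => exact .starGL ‹_› ‹_›
    | starER => exact .starGR ‹_› ‹_›
    | starFL => exact .zoneR (by grind) (by grind) (by grind) (by grind)
    | starFR => exact .zoneR (by grind) (by grind) (by grind) (by grind)
    | acrossE => exact .acrossG ‹_› ‹_› ‹_› ‹_› ‹_›
    | acrossF => exact .zoneR (by grind) (by grind) (by grind) (by grind)
    | zoneEL => exact .zoneGL ‹_› ‹_› ‹_› ‹_›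
    | zoneER => exact .zoneGR ‹_› ‹_› ‹_› ‹_›
    | zoneFL => exact .zoneR (by grind) (by grind) (by grind) (by grind)
    | zoneFR => exact .zoneR (by grind) (by grind) (by grind) (by grind)
  case le_Z₂ =>
    intro c s t h
    cases h with
    | starDL => exact .starDL ‹_› ‹_›
    | starDR => exact .starDR (by grind) (by grind)
    | starGL => exact .zoneR (by grind) (by grind) (by grind) (by grind)
    | starGR => exact .zoneR (by grind) (by grind) (by grind) (by grind)
    | nextR => exact .zoneR (by grind) (by grind) (by grind) (by grind)
    | nextL => exact .acrossD (by grind) (by grind) (by grind) (by grind) (by grind)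
    | acrossD => exact .acrossD (by grind) (by grind) (by grind) (by grind) (by grind)
    | acrossG => exact .zoneR (by grind) (by grind) (by grind) (by grind)
    | zoneL => exact .zoneL ‹_› ‹_› ‹_› ‹_›
    | zoneGL => exact .zoneR (by grind) (by grind) (by grind) (by grind)
    | zoneGR => exact .zoneR (by grind) (by grind) (by grind) (by grind)
    | zoneR => exact .zoneR (by grind) (by grind) (by grind) (by grind)
  case x_A => rw [chordsFree_singleChord]; rintro c' s t ⟨-, rfl, rfl⟩ -; grind
  case x_B => rw [chordsFree_singleChord]; rintro c' s t ⟨-, rfl, rfl⟩ -; grind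
  case A_B =>
    rw [chordsFree_singleChord]; rintro c' s t ⟨h, rfl, rfl⟩ h'; exact absurd (h'.symm.trans h) c10
  all_goals
    rw [chordsFree_singleChord]
    intro c' s t h hc'
    cases h <;> grind

/-- A vertex can be stacked to the right onto an edge with a slot. -/
theorem IsSlot.exists_right {p q : ℚ} {Z : ChordSet} (h : IsSlot p q Z) :
    ∃ (x : ℚ) (a b : Fin 5) (Z₁ Z₂ : ChordSet), q < x ∧ IsSlot p x Z₁ ∧ IsSlot q x Z₂ ∧
      SplitsAt Z x (singleChord a p x) (singleChord b q x) Z₁ Z₂ := by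
  cases h with
  | chain hc ho hZ =>
    obtain ⟨x, Z₁, Z₂, hx, h1, h2, h3⟩ := splitsAt_chainPot hc ho
    exact ⟨x, _, _, Z₁, Z₂, hx, h1, h2, h3.mono hZ⟩
  | starLeft hc ho hZ =>
    obtain ⟨x, Z₁, Z₂, hx, hx', h1, h2, h3⟩ := splitsAt_starPot hc ho
    exact ⟨x, _, _, Z₂, Z₁, hx', h2, h1, (h3.mono hZ).swap⟩
  | starRight hc ho hZ =>
    obtain ⟨x, Z₁, Z₂, hx, hx', h1, h2, h3⟩ := splitsAt_starPot hc ho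
    exact ⟨x, _, _, Z₁, Z₂, hx, h1, h2, h3.mono hZ⟩

/-- A vertex can be stacked to the left onto an edge with a slot. -/
theorem IsSlot.exists_left {p q : ℚ} {Z : ChordSet} (h : IsSlot p q Z) :
    ∃ (x : ℚ) (a b : Fin 5) (Z₁ Z₂ : ChordSet), x < p ∧ IsSlot x p Z₁ ∧ IsSlot x q Z₂ ∧
      SplitsAt Z x (singleChord a x p) (singleChord b x q) Z₁ Z₂ := by
  obtain ⟨x, a, b, Z₁, Z₂, hx, h1, h2, h3⟩ := h.mirror.exists_right
  refine ⟨-x, b, a, Z₂.mirror, Z₁.mirror, by linarith, ?_, ?_, ?_⟩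
  · simpa using h2.mirror
  · simpa using h1.mirror
  · have := h3.mirror.swap
    simpa only [ChordSet.mirror_mirror, ChordSet.mirror_singleChord, neg_neg] using this

/-! ### Stack layouts of monotone 2-trees -/

/-- The objects of a partial layout: vertices, edges, and up to two slots for each edge. -/
inductive LayoutObj (V : Type*)
  | vertex (v : V)
  | edge (p : V × V)
  | slot (p : V × V) (b : Bool)

/-- The vertex `a` is joined by edges in `E` to both ends of `p`. -/
def IsCommonNeighbor {V : Type*} (E : Set (V × V)) (p : V × V) (a : V) : Prop :=
  ((a, p.1) ∈ E ∨ (p.1, a) ∈ E) ∧ ((a, p.2) ∈ E ∨ (p.2, a) ∈ E)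

theorem IsCommonNeighbor.mono {V : Type*} {E E' : Set (V × V)} (hE : E ⊆ E') {p : V × V} {a : V}
    (h : IsCommonNeighbor E p a) : IsCommonNeighbor E' p a :=
  ⟨h.1.imp (@hE _) (@hE _), h.2.imp (@hE _) (@hE _)⟩

/-- No edge of `E` has three common neighbours of its ends. -/
def AtMostTwoCommonNeighbors {V : Type*} (E : Set (V × V)) : Prop :=
  ∀ p ∈ E, ∀ a b c, IsCommonNeighbor E p a → IsCommonNeighbor E p b → IsCommonNeighbor E p c →
    a = b ∨ a = c ∨ b = c

/-- A layout of the directed graph with vertex set `S` and edge set `E`, in which every edge has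
slots for further vertices, up to two common neighbours. -/
structure PartialLayout {V : Type*} (S : Set V) (E : Set (V × V)) (pos : V → ℚ)
    (F : LayoutObj V → ChordSet) : Prop where
  mem : ∀ p ∈ E, p.1 ∈ S ∧ p.2 ∈ S
  free : ∀ o o', o ≠ o' → ChordsFree (F o) (F o')
  vertex : ∀ v ∈ S, singleChord 0 (pos v) (pos v) ≤ F (.vertex v)
  edge : ∀ p ∈ E, ∃ c, singleChord c (pos p.1) (pos p.2) ≤ F (.edge p)
  lt : ∀ p ∈ E, pos p.1 < pos p.2
  slot : ∀ p ∈ E, (∃ b, IsSlot (pos p.1) (pos p.2) (F (.slot p b)) ∧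
      (IsSlot (pos p.1) (pos p.2) (F (.slot p (!b))) ∨ ∃ a, IsCommonNeighbor E p a)) ∨
    ∃ a a', a ≠ a' ∧ IsCommonNeighbor E p a ∧ IsCommonNeighbor E p a'

theorem chordsFree_bot (A : ChordSet) : ChordsFree A ⊥ := fun _ _ _ _ _ _ h => h.elim

theorem chordsFree_of_eq_bot {I : Type*} {F : I → ChordSet} (N : Set I) (hold : ∀ o ∉ N, F o = ⊥)
    (hN : ∀ o ∈ N, ∀ o' ∈ N, o ≠ o' → ChordsFree (F o) (F o')) :
    ∀ o o', o ≠ o' → ChordsFree (F o) (F o') := by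
  intro o o' hne
  by_cases ho : o ∈ N <;> by_cases ho' : o' ∈ N
  · exact hN o ho o' ho' hne
  · rw [hold o' ho']; exact chordsFree_bot _
  · rw [hold o ho]; exact (chordsFree_bot _).symm
  · rw [hold o' ho']; exact chordsFree_bot _

/-- Whatever is placed inside the reserve of `o₀` inherits freedom from all other objects, so only
the new objects have to be compared with each other. -/
theorem chordsFree_refine {I : Type*} {F F' : I → ChordSet}
    (hF : ∀ o o', o ≠ o' → ChordsFree (F o) (F o')) (o₀ : I) (N : Set I)
    (hold : ∀ o ∉ N, o ≠ o₀ ∧ F' o ≤ F o) (hnew : ∀ o ∈ N, F' o ≤ F o₀)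
    (hN : ∀ o ∈ N, ∀ o' ∈ N, o ≠ o' → ChordsFree (F' o) (F' o')) :
    ∀ o o', o ≠ o' → ChordsFree (F' o) (F' o') := by
  intro o o' hne
  by_cases ho : o ∈ N <;> by_cases ho' : o' ∈ N
  · exact hN o ho o' ho' hne
  · exact (hF _ _ (hold o' ho').1.symm).mono (hnew o ho) (hold o' ho').2
  · exact (hF _ _ (hold o ho).1).mono (hold o ho).2 (hnew o' ho')
  · exact (hF _ _ hne).mono (hold o ho).2 (hold o' ho').2

/-- The induction step of the block layout, stated for both directions of the new edges so that left
and right children share it. -/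
theorem PartialLayout.stack {V : Type*} {S : Set V} {E : Set (V × V)} {pos pos' : V → ℚ}
    {F : LayoutObj V → ChordSet} (h : PartialLayout S E pos F) {v w u : V} (hvw : (v, w) ∈ E)
    (hu : u ∉ S) {b : Bool} (hother : IsSlot (pos v) (pos w) (F (.slot (v, w) (!b))) ∨
      ∃ a, IsCommonNeighbor E (v, w) a)
    {p₁ p₂ : V × V} (hp₁ : p₁ = (v, u) ∨ p₁ = (u, v)) (hp₂ : p₂ = (w, u) ∨ p₂ = (u, w))
    (hpos : ∀ z ∈ S, pos' z = pos z) {c₁ c₂ : Fin 5} {Z₁ Z₂ : ChordSet}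
    (hs : SplitsAt (F (.slot (v, w) b)) (pos' u) (singleChord c₁ (pos' p₁.1) (pos' p₁.2))
      (singleChord c₂ (pos' p₂.1) (pos' p₂.2)) Z₁ Z₂)
    (hZ₁ : IsSlot (pos' p₁.1) (pos' p₁.2) Z₁) (hZ₂ : IsSlot (pos' p₂.1) (pos' p₂.2) Z₂)
    (hlt₁ : pos' p₁.1 < pos' p₁.2) (hlt₂ : pos' p₂.1 < pos' p₂.2) :
    ∃ F', PartialLayout (insert u S) (E ∪ {p₁, p₂}) pos' F' := by
  classical
  have hvS : v ∈ S := (h.mem _ hvw).1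
  have hwS : w ∈ S := (h.mem _ hvw).2
  have hvw' : v ≠ w := fun e => by have := h.lt _ hvw; simp [e] at this
  have huv : u ≠ v := fun e => hu (e ▸ hvS)
  have huw : u ≠ w := fun e => hu (e ▸ hwS)
  have hp₁E : p₁ ∉ E := fun hp => hu (by
    rcases hp₁ with rfl | rfl
    exacts [(h.mem _ hp).2, (h.mem _ hp).1])
  have hp₂E : p₂ ∉ E := fun hp => hu (by
    rcases hp₂ with rfl | rfl
    exacts [(h.mem _ hp).2, (h.mem _ hp).1])
  have hp₁₂ : p₁ ≠ p₂ := by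
    rcases hp₁ with rfl | rfl <;> rcases hp₂ with rfl | rfl <;> simp_all [Prod.ext_iff]
  have hn₁ : p₁ ≠ (v, w) := fun e => hp₁E (e ▸ hvw)
  have hn₂ : p₂ ≠ (v, w) := fun e => hp₂E (e ▸ hvw)
  -- The consumed slot is emptied and its chords go to the five new objects. One slot per new edge
  -- is enough: the third vertex of the new triangle already counts as a common neighbour.
  let F' : LayoutObj V → ChordSet := fun o =>
    if o = .vertex u then singleChord 0 (pos' u) (pos' u)
    else if o = .edge p₁ then singleChord c₁ (pos' p₁.1) (pos' p₁.2)
    else if o = .edge p₂ then singleChord c₂ (pos' p₂.1) (pos' p₂.2)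
    else if o = .slot p₁ true then Z₁
    else if o = .slot p₂ true then Z₂
    else if o = .slot (v, w) b then ⊥ else F o
  have f1 : F' (.vertex u) = singleChord 0 (pos' u) (pos' u) := by simp [F']
  have f2 : F' (.edge p₁) = singleChord c₁ (pos' p₁.1) (pos' p₁.2) := by simp [F']
  have f3 : F' (.edge p₂) = singleChord c₂ (pos' p₂.1) (pos' p₂.2) := by simp [F', hp₁₂.symm]
  have f4 : F' (.slot p₁ true) = Z₁ := by simp [F']
  have f5 : F' (.slot p₂ true) = Z₂ := by simp [F', hp₁₂.symm]
  have f6 : F' (.slot (v, w) b) = ⊥ := by simp [F', hn₁.symm, hn₂.symm]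
  have fv : ∀ z ∈ S, F' (.vertex z) = F (.vertex z) := fun z hz => by
    have : z ≠ u := fun e => hu (e ▸ hz)
    simp [F', this]
  have fe : ∀ p ∈ E, F' (.edge p) = F (.edge p) := fun p hp => by
    have h1 : p ≠ p₁ := fun e => hp₁E (e ▸ hp)
    have h2 : p ≠ p₂ := fun e => hp₂E (e ▸ hp)
    simp [F', h1, h2]
  have fs : ∀ p ∈ E, ∀ b', (p, b') ≠ ((v, w), b) → F' (.slot p b') = F (.slot p b') :=
    fun p hp b' hne => by
      have h1 : p ≠ p₁ := fun e => hp₁E (e ▸ hp)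
      have h2 : p ≠ p₂ := fun e => hp₂E (e ▸ hp)
      have h3 : ¬ (p = (v, w) ∧ b' = b) := fun e => hne (by rw [e.1, e.2])
      simp [F', h1, h2, h3]
  have hcn₁ : IsCommonNeighbor (E ∪ {p₁, p₂}) p₁ w := by
    rcases hp₁ with rfl | rfl <;> rcases hp₂ with rfl | rfl <;> simp [IsCommonNeighbor, hvw]
  have hcn₂ : IsCommonNeighbor (E ∪ {p₁, p₂}) p₂ v := by
    rcases hp₁ with rfl | rfl <;> rcases hp₂ with rfl | rfl <;> simp [IsCommonNeighbor, hvw]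
  have hcn : IsCommonNeighbor (E ∪ {p₁, p₂}) (v, w) u := by
    rcases hp₁ with rfl | rfl <;> rcases hp₂ with rfl | rfl <;> simp [IsCommonNeighbor]
  have hsub : E ⊆ E ∪ {p₁, p₂} := Set.subset_union_left
  refine ⟨F', ?_, ?_, ?_, ?_, ?_, ?_⟩
  · rintro p (hp | rfl | rfl)
    · exact ⟨Or.inr (h.mem p hp).1, Or.inr (h.mem p hp).2⟩
    · rcases hp₁ with rfl | rfl <;> simp [hvS]
    · rcases hp₂ with rfl | rfl <;> simp [hwS]
  · refine chordsFree_refine h.free (.slot (v, w) b)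
      {.vertex u, .edge p₁, .edge p₂, .slot p₁ true, .slot p₂ true, .slot (v, w) b} ?_ ?_ ?_
    · intro o ho
      simp only [Set.mem_insert_iff, Set.mem_singleton_iff, not_or] at ho
      obtain ⟨h1, h2, h3, h4, h5, h6⟩ := ho
      exact ⟨h6, by simp only [F', h1, h2, h3, h4, h5, h6, if_false]; exact le_rfl⟩
    · rintro o (rfl | rfl | rfl | rfl | rfl | rfl)
      · rw [f1]; exact hs.le_x
      · rw [f2]; exact hs.le_A
      · rw [f3]; exact hs.le_B
      · rw [f4]; exact hs.le_Z₁
      · rw [f5]; exact hs.le_Z₂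
      · rw [f6]; exact bot_le
    · rintro o (rfl | rfl | rfl | rfl | rfl | rfl) o' (rfl | rfl | rfl | rfl | rfl | rfl) hne <;>
        first
          | exact absurd rfl hne
          | (simp only [f1, f2, f3, f4, f5, f6]
             first
               | exact chordsFree_bot _
               | exact (chordsFree_bot _).symm
               | exact hs.x_A
               | exact hs.x_B
               | exact hs.x_Z₁
               | exact hs.x_Z₂
               | exact hs.A_B
               | exact hs.A_Z₁
               | exact hs.A_Z₂
               | exact hs.B_Z₁
               | exact hs.B_Z₂
               | exact hs.Z₁_Z₂
               | exact hs.x_A.symm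
               | exact hs.x_B.symm
               | exact hs.x_Z₁.symm
               | exact hs.x_Z₂.symm
               | exact hs.A_B.symm
               | exact hs.A_Z₁.symm
               | exact hs.A_Z₂.symm
               | exact hs.B_Z₁.symm
               | exact hs.B_Z₂.symm
               | exact hs.Z₁_Z₂.symm)
  · rintro z (rfl | hz)
    · rw [f1]
    · rw [fv z hz, hpos z hz]; exact h.vertex z hz
  · rintro p (hp | rfl | rfl)
    · rw [fe p hp, hpos _ (h.mem p hp).1, hpos _ (h.mem p hp).2]; exact h.edge p hp
    · exact ⟨c₁, f2.ge⟩
    · exact ⟨c₂, f3.ge⟩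
  · rintro p (hp | rfl | rfl)
    · rw [hpos _ (h.mem p hp).1, hpos _ (h.mem p hp).2]; exact h.lt p hp
    · exact hlt₁
    · exact hlt₂
  · rintro p (hp | rfl | rfl)
    · rw [hpos _ (h.mem p hp).1, hpos _ (h.mem p hp).2]
      by_cases hpvw : p = (v, w)
      · subst hpvw
        rcases hother with ho | ⟨a, ha⟩
        · refine Or.inl ⟨!b, ?_, Or.inr ⟨u, hcn⟩⟩
          rw [fs _ hvw _ (by simp)]; exact ho
        · refine Or.inr ⟨a, u, ?_, ha.mono hsub, hcn⟩
          rintro rfl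
          rcases ha.1 with ha | ha
          exacts [hu (h.mem _ ha).1, hu (h.mem _ ha).2]
      · have hf : ∀ b', F' (.slot p b') = F (.slot p b') := fun b' =>
          fs p hp b' fun e => hpvw (congrArg Prod.fst e)
        simp only [hf]
        rcases h.slot p hp with ⟨b', h1, h2⟩ | ⟨a, a', hne, h1, h2⟩
        · exact Or.inl ⟨b', h1, h2.imp id fun ⟨a, ha⟩ => ⟨a, ha.mono hsub⟩⟩
        · exact Or.inr ⟨a, a', hne, h1.mono hsub, h2.mono hsub⟩
    · exact Or.inl ⟨true, by rw [f4]; exact hZ₁, Or.inr ⟨w, hcn₁⟩⟩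
    · exact Or.inl ⟨true, by rw [f5]; exact hZ₂, Or.inr ⟨v, hcn₂⟩⟩

theorem chainColors_base (k : Fin 5) (hk : k = 1 ∨ k = 2) : ChainColors k 3 4 3 4 := by
  rcases hk with rfl | rfl <;> constructor <;> decide

/-- At either end the zones of the second slot surround those of the first, so chords across an end
nest even in the shared colours `3, 4`. The chain chords are separated by their colours `1` and `2`.
-/
theorem chordsFree_chainPot_base :
    ChordsFree (ChainPot 1 3 4 3 4 0 20 (-2) (-1) 1 2 18 19 21 22)
      (ChainPot 2 3 4 3 4 0 20 (-4) (-3) 3 4 16 17 23 24) := by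
  intro c s t s' t' hA hB
  cases hA <;> cases hB <;> grind

theorem exists_partialLayout_base {V : Type*} {x y : V} (hxy : x ≠ y) :
    ∃ pos F, PartialLayout {x, y} {(x, y)} pos F := by
  classical
  let Z₁ : ChordSet := ChainPot 1 3 4 3 4 0 20 (-2) (-1) 1 2 18 19 21 22
  let Z₂ : ChordSet := ChainPot 2 3 4 3 4 0 20 (-4) (-3) 3 4 16 17 23 24
  let pos : V → ℚ := fun v => if v = x then 0 else 20
  have hx : pos x = 0 := by simp [pos]
  have hy : pos y = 20 := by simp [pos, hxy.symm]
  let F : LayoutObj V → ChordSet := fun o =>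
    if o = .vertex x then singleChord 0 0 0
    else if o = .vertex y then singleChord 0 20 20
    else if o = .edge (x, y) then singleChord 0 0 20
    else if o = .slot (x, y) true then Z₁
    else if o = .slot (x, y) false then Z₂ else ⊥
  have f1 : F (.vertex x) = singleChord 0 0 0 := by simp [F]
  have f2 : F (.vertex y) = singleChord 0 20 20 := by simp [F, hxy.symm]
  have f3 : F (.edge (x, y)) = singleChord 0 0 20 := by simp [F]
  have f4 : F (.slot (x, y) true) = Z₁ := by simp [F]
  have f5 : F (.slot (x, y) false) = Z₂ := by simp [F]
  have slot : ∀ {k : Fin 5} {a₁ a₂ a₃ a₄ b₁ b₂ b₃ b₄ : ℚ}, (k = 1 ∨ k = 2) →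
      ChainOrder 0 20 a₁ a₂ a₃ a₄ b₁ b₂ b₃ b₄ →
      IsSlot 0 20 (ChainPot k 3 4 3 4 0 20 a₁ a₂ a₃ a₄ b₁ b₂ b₃ b₄) := fun hk ho =>
    .chain (chainColors_base _ hk) ho le_rfl
  have s1 : IsSlot 0 20 Z₁ := slot (Or.inl rfl) (by constructor <;> norm_num)
  have s2 : IsSlot 0 20 Z₂ := slot (Or.inr rfl) (by constructor <;> norm_num)
  have v12 : ChordsFree (singleChord 0 0 0) (singleChord 0 20 20) := by
    rw [chordsFree_singleChord]; rintro c s t ⟨-, rfl, rfl⟩ -; norm_num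
  have v1e : ChordsFree (singleChord 0 0 0) (singleChord 0 0 20) := by
    rw [chordsFree_singleChord]; rintro c s t ⟨-, rfl, rfl⟩ -; norm_num
  have v2e : ChordsFree (singleChord 0 20 20) (singleChord 0 0 20) := by
    rw [chordsFree_singleChord]; rintro c s t ⟨-, rfl, rfl⟩ -; norm_num
  have v1Z₁ : ChordsFree (singleChord 0 0 0) Z₁ := by
    rw [chordsFree_singleChord]; intro c s t h hc; cases h <;> grind
  have v2Z₁ : ChordsFree (singleChord 0 20 20) Z₁ := by
    rw [chordsFree_singleChord]; intro c s t h hc; cases h <;> grind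
  have v1Z₂ : ChordsFree (singleChord 0 0 0) Z₂ := by
    rw [chordsFree_singleChord]; intro c s t h hc; cases h <;> grind
  have v2Z₂ : ChordsFree (singleChord 0 20 20) Z₂ := by
    rw [chordsFree_singleChord]; intro c s t h hc; cases h <;> grind
  have eZ₁ : ChordsFree (singleChord 0 0 20) Z₁ := by
    rw [chordsFree_singleChord]; intro c s t h hc; cases h <;> grind
  have eZ₂ : ChordsFree (singleChord 0 0 20) Z₂ := by
    rw [chordsFree_singleChord]; intro c s t h hc; cases h <;> grind
  have ZZ : ChordsFree Z₁ Z₂ := chordsFree_chainPot_base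
  refine ⟨pos, F, ?_, ?_, ?_, ?_, ?_, ?_⟩
  · rintro p rfl; simp
  · refine chordsFree_of_eq_bot
      {.vertex x, .vertex y, .edge (x, y), .slot (x, y) true, .slot (x, y) false} ?_ ?_
    · intro o ho
      simp only [Set.mem_insert_iff, Set.mem_singleton_iff, not_or] at ho
      obtain ⟨h1, h2, h3, h4, h5⟩ := ho
      simp only [F, h1, h2, h3, h4, h5, if_false]
    · rintro o (rfl | rfl | rfl | rfl | rfl) o' (rfl | rfl | rfl | rfl | rfl) hne <;>
        first
          | exact absurd rfl hne
          | (simp only [f1, f2, f3, f4, f5]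
             first
               | assumption
               | (apply ChordsFree.symm; assumption))
  · rintro v (rfl | rfl)
    · rw [f1, hx]
    · rw [f2, hy]
  · rintro p rfl; exact ⟨0, by rw [f3, hx, hy]⟩
  · rintro p rfl; rw [hx, hy]; norm_num
  · rintro p rfl
    refine Or.inl ⟨true, ?_, Or.inl ?_⟩
    · rw [hx, hy, f4]; exact s1
    · rw [hx, hy, Bool.not_true, f5]; exact s2

/-- A monotone 2-tree in which the ends of every edge have at most two common neighbours has a
partial layout. -/
theorem StackedTwoTree.exists_partialLayout {V : Type*} {x y : V} {S : Set V} {E : Set (V × V)}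
    (h : StackedTwoTree Stacking.IsMonotone x y S E) (hE : AtMostTwoCommonNeighbors E) :
    ∃ pos F, PartialLayout S E pos F := by
  classical
  induction h with
  | base hxy => exact exists_partialLayout_base hxy
  | @stack S E hSE v w hvw u hu t ht ih =>
    have hcn : IsCommonNeighbor (E ∪ t.newEdges u v w) (v, w) u := by
      rcases ht with rfl | rfl <;> simp [IsCommonNeighbor, Stacking.newEdges]
    have hsub : E ⊆ E ∪ t.newEdges u v w := Set.subset_union_left
    obtain ⟨pos, F, hF⟩ := ih fun p hp a b c ha hb hc =>
      hE p (hsub hp) a b c (ha.mono hsub) (hb.mono hsub) (hc.mono hsub)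
    have hnu : ∀ a, IsCommonNeighbor E (v, w) a → a ≠ u := by
      rintro a ha rfl
      rcases ha.1 with ha | ha
      exacts [hu (hF.mem _ ha).1, hu (hF.mem _ ha).2]
    have hvu : v ≠ u := fun e => hu (e ▸ (hF.mem _ hvw).1)
    have hwu : w ≠ u := fun e => hu (e ▸ (hF.mem _ hvw).2)
    rcases hF.slot _ hvw with ⟨b, hb, hother⟩ | ⟨a, a', hne, ha, ha'⟩
    swap
    -- No slot is left only if two common neighbours exist already; `u` would be a third.
    · rcases hE _ (hsub hvw) a a' u (ha.mono hsub) (ha'.mono hsub) hcn with h | h | h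
      exacts [absurd h hne, absurd h (hnu a ha), absurd h (hnu a' ha')]
    have hupd : ∀ (x : ℚ), ∀ z ∈ S, Function.update pos u x z = pos z := fun x z hz =>
      Function.update_of_ne (fun e : z = u => hu (e ▸ hz)) _ _
    have hlt := hF.lt _ hvw
    rcases ht with rfl | rfl
    · obtain ⟨x, a, c, Z₁, Z₂, hx, h1, h2, hs⟩ := hb.exists_left
      obtain ⟨F', hF'⟩ := hF.stack (pos' := Function.update pos u x) hvw hu (b := b) hother
        (p₁ := (u, v)) (p₂ := (u, w)) (Or.inr rfl) (Or.inr rfl) (hupd x) (c₁ := a) (c₂ := c)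
        (Z₁ := Z₁) (Z₂ := Z₂)
        (by simpa [hvu, hwu] using hs) (by simpa [hvu, hwu] using h1)
        (by simpa [hvu, hwu] using h2) (by simpa [hvu, hwu] using hx)
        (by simpa [hvu, hwu] using hx.trans hlt)
      exact ⟨_, F', hF'⟩
    · obtain ⟨x, a, c, Z₁, Z₂, hx, h1, h2, hs⟩ := hb.exists_right
      obtain ⟨F', hF'⟩ := hF.stack (pos' := Function.update pos u x) hvw hu (b := b) hother
        (p₁ := (v, u)) (p₂ := (w, u)) (Or.inl rfl) (Or.inl rfl) (hupd x) (c₁ := a) (c₂ := c)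
        (Z₁ := Z₁) (Z₂ := Z₂)
        (by simpa [hvu, hwu] using hs) (by simpa [hvu, hwu] using h1)
        (by simpa [hvu, hwu] using h2) (by simpa [hvu, hwu] using hlt.trans hx)
        (by simpa [hvu, hwu] using hx)
      exact ⟨_, F', hF'⟩

/-- The positions and edge colours of a stack layout of the directed graph with vertex set `S` and
edge set `E`, with colours from `K`. -/
structure IsStackLayoutOn {V K : Type*} (S : Set V) (E : Set (V × V)) (pos : V → ℚ)
    (col : V × V → K) : Prop where
  inj : Set.InjOn pos S
  lt : ∀ p ∈ E, pos p.1 < pos p.2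
  noncrossing : ∀ p ∈ E, ∀ q ∈ E, col p = col q →
    ¬ (pos p.1 < pos q.1 ∧ pos q.1 < pos p.2 ∧ pos p.2 < pos q.2)

theorem IsMonotoneTwoTree.exists_isStackLayoutOn {V : Type*} {S : Set V} {E : Set (V × V)}
    (h : IsMonotoneTwoTree S E) (hE : AtMostTwoCommonNeighbors E) :
    ∃ (pos : V → ℚ) (col : V × V → Fin 5), IsStackLayoutOn S E pos col := by
  classical
  obtain ⟨x, y, h⟩ := h
  obtain ⟨pos, F, hF⟩ := h.exists_partialLayout hE
  choose! col hcol using hF.edge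
  refine ⟨pos, col, ?_, hF.lt, ?_⟩
  · intro v hv w hw hvw
    by_contra hne
    have := hF.free (.vertex v) (.vertex w) (by simpa using hne) 0 _ _ _ _
      (hF.vertex v hv _ _ _ ⟨rfl, rfl, rfl⟩) (hF.vertex w hw _ _ _ ⟨rfl, rfl, rfl⟩)
    exact this.2.2 ⟨rfl, rfl, hvw⟩
  · intro p hp q hq hpq hcross
    have hne : p ≠ q := by rintro rfl; exact lt_irrefl _ hcross.1
    have := hF.free (.edge p) (.edge q) (by simpa using hne) (col p) _ _ _ _
      (hcol p hp _ _ _ ⟨rfl, rfl, rfl⟩) (hcol q hq _ _ _ ⟨hpq, rfl, rfl⟩)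
    exact this.1 hcross

/-! ### Connected vertex sets -/

/-- The vertex set `A` induces a connected subgraph: every proper cut is crossed by an edge. -/
def SimpleGraph.ConnectedOn {V : Type*} (G : SimpleGraph V) (A : Set V) : Prop :=
  ∀ T ⊆ A, T.Nonempty → (A \ T).Nonempty → ∃ u ∈ T, ∃ v ∈ A \ T, G.Adj u v

theorem SimpleGraph.Connected.connectedOn_univ {V : Type*} {G : SimpleGraph V}
    (hG : G.Connected) : G.ConnectedOn Set.univ := by
  rintro T - ⟨x, hx⟩ ⟨y, -, hy⟩
  obtain ⟨p⟩ := hG.preconnected x y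
  obtain ⟨d, -, h1, h2⟩ := p.exists_boundary_dart T hx hy
  exact ⟨_, h1, _, ⟨trivial, h2⟩, d.adj⟩

theorem SimpleGraph.ConnectedOn.connected {V W : Type*} {G : SimpleGraph V} {A : Set V}
    (hA : G.ConnectedOn A) (hne : A.Nonempty) (H : SimpleGraph W) (f : W → V)
    (hrange : Set.range f = A) (hf : Function.Injective f)
    (hadj : ∀ a b, G.Adj (f a) (f b) → H.Adj a b) : H.Connected := by
  obtain ⟨x, hx⟩ := hne
  rw [← hrange] at hx
  obtain ⟨x, rfl⟩ := hx
  rw [SimpleGraph.connected_iff_exists_forall_reachable]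
  refine ⟨x, ?_⟩
  by_contra! hcon
  obtain ⟨y, hy⟩ := hcon
  obtain ⟨_, ⟨u, hu, rfl⟩, _, ⟨hvA, hv⟩, huv⟩ := hA (f '' {z | H.Reachable x z})
    (by rw [← hrange]; exact Set.image_subset_range _ _) ⟨_, x, SimpleGraph.Reachable.refl x, rfl⟩
    ⟨f y, by rw [← hrange]; exact ⟨y, rfl⟩, fun ⟨z, hz, hzy⟩ => hy (hf hzy ▸ hz)⟩
  rw [← hrange] at hvA
  obtain ⟨v, rfl⟩ := hvA
  exact hv ⟨v, SimpleGraph.Reachable.trans hu (hadj _ _ huv).reachable, rfl⟩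

/-- A nonempty subset of `B` has an edge leaving it inside `A`, and this edge can only end in `B` or
at `c`. For cuts containing `c` the complementary side is used. -/
theorem SimpleGraph.ConnectedOn.insert_of_no_adj {V : Type*} {G : SimpleGraph V} {A B : Set V}
    {c : V} (hA : G.ConnectedOn A) (hc : c ∈ A) (hBA : B ⊆ A \ {c})
    (hB : ∀ u ∈ B, ∀ v ∈ (A \ {c}) \ B, ¬ G.Adj u v) : G.ConnectedOn (insert c B) := by
  have key : ∀ T ⊆ B, T.Nonempty → ∃ u ∈ T, ∃ v ∈ insert c B \ T, G.Adj u v := by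
    intro T hT hne
    obtain ⟨u, hu, v, ⟨hvA, hvT⟩, huv⟩ := hA T (fun z hz => (hBA (hT hz)).1) hne
      ⟨c, hc, fun h => (hBA (hT h)).2 rfl⟩
    refine ⟨u, hu, v, ⟨?_, hvT⟩, huv⟩
    by_contra hv
    simp only [Set.mem_insert_iff, not_or] at hv
    exact hB u (hT hu) v ⟨⟨hvA, hv.1⟩, hv.2⟩ huv
  intro T hT hne hne'
  by_cases hcT : c ∈ T
  · obtain ⟨u, hu, v, hv, huv⟩ := key (insert c B \ T) (by
      rintro z ⟨rfl | hz, hz'⟩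
      exacts [absurd hcT hz', hz]) hne'
    rw [Set.sdiff_sdiff_cancel_left hT] at hv
    exact ⟨v, hv, u, hu, huv.symm⟩
  · exact key T (fun z hz => (hT hz).resolve_left fun h => hcT (h ▸ hz)) hne

/-! ### Gluing layouts at a cut vertex -/

/-- The edges of `D` with both ends in `A`. -/
def Digraph.edgesOn {V : Type*} (D : Digraph V) (A : Set V) : Set (V × V) :=
  {p | D.Adj p.1 p.2 ∧ p.1 ∈ A ∧ p.2 ∈ A}

theorem IsStackLayoutOn.mono {V K : Type*} {S S' : Set V} {E E' : Set (V × V)} {pos : V → ℚ}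
    {col : V × V → K} (h : IsStackLayoutOn S E pos col) (hS : S' ⊆ S) (hE : E' ⊆ E) :
    IsStackLayoutOn S' E' pos col :=
  ⟨h.inj.mono hS, fun p hp => h.lt p (hE hp),
    fun p hp q hq => h.noncrossing p (hE hp) q (hE hq)⟩

/-- A stack layout of the subgraph induced by `A` with root `r`. The colour `none` is reserved for
star edges, every other colour carries a parity. -/
structure RootedLayout {V K : Type*} (D : Digraph V) (A : Set V) (r : V) (pos : V → ℚ)
    (col : V × V → Option (Bool × K)) (d : V → Bool) : Prop where
  layout : IsStackLayoutOn A (D.edgesOn A) pos col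
  root : ∀ p ∈ D.edgesOn A, p.1 = r ∨ p.2 = r → col p = none
  cover : ∀ p ∈ D.edgesOn A, pos p.1 < pos r → pos r < pos p.2 → ∃ i, col p = some (!d r, i)
  vert : ∀ p ∈ D.edgesOn A, ∀ v, v = p.1 ∨ v = p.2 → col p = none ∨ ∃ i, col p = some (d v, i)

/-- Edges at `r` share an end and never cross, so they can all take the extra colour. The root gets
parity `false`, everything else `true`. -/
theorem IsStackLayoutOn.exists_rootedLayout {V K : Type*} {D : Digraph V} {A : Set V}
    {pos : V → ℚ} {col : V × V → K} (h : IsStackLayoutOn A (D.edgesOn A) pos col) (r : V) :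
    ∃ col' d, RootedLayout (K := K) D A r pos col' d := by
  classical
  refine ⟨fun p => if p.1 = r ∨ p.2 = r then none else some (true, col p), fun v => v ≠ r,
    ⟨h.inj, h.lt, ?_⟩, ?_, ?_, ?_⟩
  · intro p hp q hq hpq hcross
    have h1 : p.1 ≠ q.1 := fun e => by rw [e] at hcross; exact lt_irrefl _ hcross.1
    have h2 : p.2 ≠ q.2 := fun e => by rw [e] at hcross; exact lt_irrefl _ hcross.2.2
    have h3 : q.1 ≠ p.2 := fun e => by rw [e] at hcross; exact lt_irrefl _ hcross.2.1
    have h4 : p.1 ≠ q.2 := fun e => by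
      have := hcross.1.trans (hcross.2.1.trans hcross.2.2)
      rw [e] at this; exact lt_irrefl _ this
    by_cases hpr : p.1 = r ∨ p.2 = r <;> by_cases hqr : q.1 = r ∨ q.2 = r <;>
      simp only [hpr, hqr, if_true, if_false, reduceCtorEq] at hpq
    · grind
    · exact h.noncrossing p hp q hq (by simpa using hpq) hcross
  · intro p hp hr
    simp only [hr, if_true]
  · intro p hp h1 h2
    have : ¬ (p.1 = r ∨ p.2 = r) := by
      rintro (e | e)
      · rw [e] at h1; exact lt_irrefl _ h1
      · rw [e] at h2; exact lt_irrefl _ h2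
    simp [this]
  · rintro p hp v hv
    by_cases hpr : p.1 = r ∨ p.2 = r
    · simp [hpr]
    · have : v ≠ r := by rintro rfl; exact hpr (hv.imp Eq.symm Eq.symm)
      simp [hpr, this]

/-- All conditions are invariant under flipping every parity at once. -/
theorem RootedLayout.exists_parity {V K : Type*} {D : Digraph V} {A : Set V} {r : V} {pos : V → ℚ}
    {col : V × V → Option (Bool × K)} {d : V → Bool} (h : RootedLayout D A r pos col d) (b : Bool) :
    ∃ col' d', RootedLayout (K := K) D A r pos col' d' ∧ d' r = b := by
  let f : Option (Bool × K) → Option (Bool × K) := Option.map (Prod.map (xor (xor b (d r))) id)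
  have hf : Function.Injective f := Option.map_injective
    (Function.Injective.prodMap (fun x y hxy => by simpa using hxy) Function.injective_id)
  refine ⟨f ∘ col, fun v => xor (xor b (d r)) (d v), ⟨⟨h.layout.inj, h.layout.lt, ?_⟩, ?_, ?_, ?_⟩,
    by simp⟩
  · exact fun p hp q hq hpq => h.layout.noncrossing p hp q hq (hf hpq)
  · intro p hp hr
    simp [f, h.root p hp hr]
  · intro p hp h1 h2
    obtain ⟨i, hi⟩ := h.cover p hp h1 h2
    exact ⟨i, by simp [f, hi]⟩
  · intro p hp v hv
    rcases h.vert p hp v hv with hn | ⟨i, hi⟩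
    · exact Or.inl (by simp [f, hn])
    · exact Or.inr ⟨i, by simp [f, hi]⟩

/-- Positions for a union of two vertex sets with a common vertex `c`: the second one replaces `c`
in the first one. -/
theorem exists_glued_positions {V : Type*} [Finite V] {A B : Set V} {c : V} (hcA : c ∈ A)
    (hAB : A ∩ B ⊆ {c}) {pos₁ pos₂ : V → ℚ} (hinj : Set.InjOn pos₁ A) :
    ∃ pos : V → ℚ, (∀ a ∈ A, pos a = pos₁ a) ∧
      (∀ u ∈ B, ∀ v ∈ B, pos u < pos v ↔ pos₂ u < pos₂ v) ∧
      (∀ a ∈ A, a ≠ c → ∀ v ∈ B, (pos a < pos v ↔ pos₁ a < pos₁ c) ∧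
        (pos v < pos a ↔ pos₁ c < pos₁ a)) := by
  classical
  obtain ⟨M, hM⟩ : ∃ M : ℚ, ∀ v, |pos₂ v - pos₂ c| < M := by
    obtain ⟨M, hM⟩ := (Set.finite_range fun v => |pos₂ v - pos₂ c|).bddAbove
    exact ⟨M + 1, fun v => lt_of_le_of_lt (hM ⟨v, rfl⟩) (lt_add_one M)⟩
  have hM0 : 0 < M := lt_of_le_of_lt (abs_nonneg _) (hM c)
  obtain ⟨δ, hδ0, hδ⟩ : ∃ δ : ℚ, 0 < δ ∧ ∀ a ∈ A, a ≠ c → δ ≤ |pos₁ a - pos₁ c| := by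
    have hfin := Set.toFinite ((fun a => |pos₁ a - pos₁ c|) '' (A \ {c}))
    by_cases hne : (A \ {c}).Nonempty
    · obtain ⟨m, ⟨hm, hmin⟩⟩ := hfin.exists_minimal (hne.image _)
      obtain ⟨a, ha, rfl⟩ := hm
      refine ⟨_, abs_pos.2 (sub_ne_zero.2 fun e => ha.2 (hinj ha.1 hcA e)), fun a' ha' hne' => ?_⟩
      exact (le_total _ _).elim id fun h => hmin ⟨a', ⟨ha', hne'⟩, rfl⟩ h
    · exact ⟨1, one_pos, fun a ha hac => absurd ⟨a, ha, hac⟩ hne⟩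
  -- The second layout is shrunk into the gap of radius `δ` around `pos₁ c`, with `c` itself at the
  -- centre.
  let φ : V → ℚ := fun v => pos₁ c + δ / M * (pos₂ v - pos₂ c)
  have hφ : ∀ v, |φ v - pos₁ c| < δ := by
    intro v
    simp only [φ, add_sub_cancel_left, abs_mul, abs_of_pos (div_pos hδ0 hM0)]
    calc δ / M * |pos₂ v - pos₂ c| < δ / M * M :=
          mul_lt_mul_of_pos_left (hM v) (div_pos hδ0 hM0)
      _ = δ := div_mul_cancel₀ _ hM0.ne'
  have hφB : ∀ v ∈ B, (if v ∈ A then pos₁ v else φ v) = φ v := by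
    intro v hv
    split_ifs with hvA
    · have : v = c := hAB ⟨hvA, hv⟩
      simp [φ, this]
    · rfl
  refine ⟨fun v => if v ∈ A then pos₁ v else φ v, fun a ha => by simp [ha], ?_, ?_⟩
  · intro u hu v hv
    simp only [hφB u hu, hφB v hv, φ]
    rw [add_lt_add_iff_left, mul_lt_mul_iff_right₀ (div_pos hδ0 hM0), sub_lt_sub_iff_right]
  · intro a ha hac v hv
    simp only [hφB v hv, ha, if_true]
    have h1 := abs_lt.1 (hφ v)
    have h2 := hδ a ha hac
    rcases le_abs.1 h2 with h2 | h2
    · exact ⟨⟨fun _ => by linarith, fun _ => by linarith⟩,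
        ⟨fun _ => by linarith, fun _ => by linarith⟩⟩
    · exact ⟨⟨fun _ => by linarith, fun _ => by linarith⟩,
        ⟨fun _ => by linarith, fun _ => by linarith⟩⟩

/-- To a vertex of `A` other than `c`, all of `B` looks like the single point `c`. So an edge of `A`
crosses an edge of `B` only if it ends at `c` and the other passes over `c`. The former has the
extra colour or the parity of `c`, the latter the opposite parity. -/
theorem RootedLayout.glue {V K : Type*} [Finite V] {D : Digraph V} {A B : Set V} {r c : V}
    {pos₁ pos₂ : V → ℚ} {col₁ col₂ : V × V → Option (Bool × K)} {d₁ d₂ : V → Bool}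
    (h₁ : RootedLayout D A r pos₁ col₁ d₁) (h₂ : RootedLayout D B c pos₂ col₂ d₂)
    (hr : r ∈ A) (hcA : c ∈ A) (hcB : c ∈ B) (hAB : A ∩ B ⊆ {c}) (hd : d₂ c = d₁ c)
    (hedge : D.edgesOn (A ∪ B) ⊆ D.edgesOn A ∪ D.edgesOn B) :
    ∃ pos col d, RootedLayout (K := K) D (A ∪ B) r pos col d := by
  classical
  obtain ⟨pos, hA, hB, hX⟩ := exists_glued_positions (pos₂ := pos₂) hcA hAB h₁.layout.inj
  have hB' : Set.InjOn pos B := by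
    intro u hu v hv huv
    apply h₂.layout.inj hu hv
    have h1 := hB u hu v hv
    have h2 := hB v hv u hu
    rw [huv, lt_self_iff_false, false_iff, not_lt] at h1 h2
    exact le_antisymm h2 h1
  have hne₂ : ∀ p ∈ D.edgesOn B, ¬ (p.1 ∈ A ∧ p.2 ∈ A) := by
    rintro p hp ⟨h1, h2⟩
    have := h₂.layout.lt p hp
    rw [hAB ⟨h1, hp.2.1⟩, hAB ⟨h2, hp.2.2⟩] at this
    exact lt_irrefl _ this
  let col : V × V → Option (Bool × K) := fun p => if p.1 ∈ A ∧ p.2 ∈ A then col₁ p else col₂ p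
  have hcol₁ : ∀ p ∈ D.edgesOn A, col p = col₁ p := fun p hp => by simp [col, hp.2.1, hp.2.2]
  have hcol₂ : ∀ p ∈ D.edgesOn B, col p = col₂ p := fun p hp => by
    simp only [col, hne₂ p hp, if_false]
  have hdis : ∀ {b : Bool} {i j : K}, (some (b, i) : Option (Bool × K)) ≠ some (!b, j) := by
    intro b i j; cases b <;> simp
  -- an edge of `A` ending at `c` and an edge of `B` covering `c` have different colours
  have hdiff : ∀ p ∈ D.edgesOn A, ∀ q ∈ D.edgesOn B, c = p.1 ∨ c = p.2 → pos q.1 < pos c →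
      pos c < pos q.2 → col p ≠ col q := by
    intro p hp q hq hc h1 h2 e
    rw [hB _ hq.2.1 _ hcB] at h1
    rw [hB _ hcB _ hq.2.2] at h2
    obtain ⟨i, hi⟩ := h₂.cover q hq h1 h2
    rw [hcol₁ p hp, hcol₂ q hq, hi, hd] at e
    rcases h₁.vert p hp c hc with hn | ⟨j, hj⟩
    · rw [hn] at e; simp at e
    · rw [hj] at e; exact hdis e
  refine ⟨pos, col, fun v => if v ∈ A then d₁ v else d₂ v, ⟨?_, ?_, ?_⟩, ?_, ?_, ?_⟩
  · have hmix : ∀ u ∈ A, ∀ v ∈ B, pos u = pos v → u = v := by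
      intro u hu v hv huv
      by_cases huc : u = c
      · subst huc; exact hB' hcB hv huv
      · have := hX u hu huc v hv
        rw [huv, lt_self_iff_false, false_iff, false_iff] at this
        exact absurd (h₁.layout.inj hu hcA (le_antisymm (not_lt.1 this.2) (not_lt.1 this.1))) huc
    rintro u (hu | hu) v (hv | hv) huv
    · rw [hA u hu, hA v hv] at huv; exact h₁.layout.inj hu hv huv
    · exact hmix u hu v hv huv
    · exact (hmix v hv u hu huv.symm).symm
    · exact hB' hu hv huv
  · intro p hp
    rcases hedge hp with hp | hp
    · rw [hA _ hp.2.1, hA _ hp.2.2]; exact h₁.layout.lt p hp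
    · rw [hB _ hp.2.1 _ hp.2.2]; exact h₂.layout.lt p hp
  · rintro p hp q hq hpq ⟨x1, x2, x3⟩
    rcases hedge hp with hp | hp <;> rcases hedge hq with hq | hq
    · rw [hcol₁ p hp, hcol₁ q hq] at hpq
      rw [hA _ hp.2.1, hA _ hq.2.1] at x1
      rw [hA _ hp.2.2, hA _ hq.2.1] at x2
      rw [hA _ hp.2.2, hA _ hq.2.2] at x3
      exact h₁.layout.noncrossing p hp q hq hpq ⟨x1, x2, x3⟩
    -- If `p` does not end at `c`, all of `B` lies on one side of `p.2`, so `q` cannot straddle it.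
    · by_cases hc : p.2 = c
      · rw [hc] at x2 x3
        exact hdiff p hp q hq (Or.inr hc.symm) x2 x3 hpq
      · rw [(hX _ hp.2.2 hc _ hq.2.1).2] at x2
        rw [(hX _ hp.2.2 hc _ hq.2.2).1] at x3
        exact lt_asymm x2 x3
    · by_cases hc : q.1 = c
      · rw [hc] at x1 x2
        exact hdiff q hq p hp (Or.inl hc.symm) x1 x2 hpq.symm
      · rw [(hX _ hq.2.1 hc _ hp.2.1).2] at x1
        rw [(hX _ hq.2.1 hc _ hp.2.2).1] at x2
        exact lt_asymm x1 x2
    · rw [hcol₂ p hp, hcol₂ q hq] at hpq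
      rw [hB _ hp.2.1 _ hq.2.1] at x1
      rw [hB _ hq.2.1 _ hp.2.2] at x2
      rw [hB _ hp.2.2 _ hq.2.2] at x3
      exact h₂.layout.noncrossing p hp q hq hpq ⟨x1, x2, x3⟩
  · intro p hp hpr
    rcases hedge hp with hp | hp
    · rw [hcol₁ p hp]; exact h₁.root p hp hpr
    · rw [hcol₂ p hp]
      have : r = c := by
        rcases hpr with rfl | rfl
        exacts [hAB ⟨hr, hp.2.1⟩, hAB ⟨hr, hp.2.2⟩]
      exact h₂.root p hp (this ▸ hpr)
  · intro p hp x1 x2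
    simp only [hr, if_true]
    rcases hedge hp with hp | hp
    · rw [hcol₁ p hp]
      rw [hA _ hp.2.1, hA _ hr] at x1
      rw [hA _ hp.2.2, hA _ hr] at x2
      exact h₁.cover p hp x1 x2
    · by_cases hrc : r = c
      · subst hrc
        rw [hcol₂ p hp, ← hd]
        rw [hB _ hp.2.1 _ hcB] at x1
        rw [hB _ hcB _ hp.2.2] at x2
        exact h₂.cover p hp x1 x2
      · rw [(hX _ hr hrc _ hp.2.1).2] at x1
        rw [(hX _ hr hrc _ hp.2.2).1] at x2
        exact absurd x1 (lt_asymm x2)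
  · intro p hp v hv
    rcases hedge hp with hp | hp
    · have hvA : v ∈ A := by rcases hv with rfl | rfl; exacts [hp.2.1, hp.2.2]
      simp only [hvA, if_true, hcol₁ p hp]
      exact h₁.vert p hp v hv
    · have hvB : v ∈ B := by rcases hv with rfl | rfl; exacts [hp.2.1, hp.2.2]
      have : (if v ∈ A then d₁ v else d₂ v) = d₂ v := by
        split_ifs with hvA
        · rw [hAB ⟨hvA, hvB⟩, hd]
        · rfl
      simp only [this, hcol₂ p hp]
      exact h₂.vert p hp v hv

/-! ### Block-monotone outerplanar graphs -/

theorem isTwoConnected_induce_top {V : Type*} {G : SimpleGraph V} {A : Set V}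
    (hcard : 3 ≤ A.encard) (hA : G.ConnectedOn A) (hcut : ∀ c ∈ A, G.ConnectedOn (A \ {c})) :
    IsTwoConnected ((⊤ : G.Subgraph).induce A).coe := by
  have hne : ∀ c, (A \ {c}).Nonempty := by
    intro c
    by_contra hempty
    have h1 : A ⊆ {c} := Set.sdiff_eq_empty.1 (Set.not_nonempty_iff_eq_empty.1 hempty)
    have := hcard.trans ((Set.encard_le_encard h1).trans_eq (Set.encard_singleton c))
    norm_num at this
  refine ⟨hcard, ?_, ?_⟩
  · have hne' : A.Nonempty := by
      by_contra hempty
      rw [Set.not_nonempty_iff_eq_empty] at hempty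
      simp [hempty] at hcard
    refine hA.connected hne' _ Subtype.val Subtype.range_val Subtype.val_injective ?_
    rintro ⟨a, ha⟩ ⟨b, hb⟩ hab
    exact ⟨ha, hb, hab⟩
  · rintro ⟨c, hc⟩
    refine (hcut c hc).connected (hne c) _ (fun z => z.1.1) ?_
      (fun z z' h => Subtype.ext (Subtype.ext h)) ?_
    · ext z
      constructor
      · rintro ⟨⟨⟨z, hz⟩, hzc⟩, rfl⟩
        exact ⟨hz, fun h => hzc (Subtype.ext h)⟩
      · rintro ⟨hz, hzc⟩
        exact ⟨⟨⟨z, hz⟩, fun h => hzc (congrArg Subtype.val h)⟩, rfl⟩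
    · rintro ⟨⟨a, ha⟩, _⟩ ⟨⟨b, hb⟩, _⟩ hab
      exact ⟨ha, hb, hab⟩

theorem Digraph.IsDAG.ne {V : Type*} {D : Digraph V} (hD : D.IsDAG) {a b : V} (h : D.Adj a b) :
    a ≠ b := by
  rintro rfl; exact hD a (.single h)

theorem Digraph.IsDAG.toSimpleGraphInclusive_adj {V : Type*} {D : Digraph V} (hD : D.IsDAG)
    {a b : V} (h : D.Adj a b ∨ D.Adj b a) : D.toSimpleGraphInclusive.Adj a b :=
  ⟨h.elim hD.ne fun h => (hD.ne h).symm, h⟩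

/-- The ends of the edge are the poles of a `K_{2,3}`. -/
theorem Digraph.IsDAG.atMostTwoCommonNeighbors {V : Type*} {D : Digraph V} (hD : D.IsDAG)
    (hout : IsOuterplanar D.toSimpleGraphInclusive) {E : Set (V × V)}
    (hE : ∀ p ∈ E, D.Adj p.1 p.2) : AtMostTwoCommonNeighbors E := by
  intro p hp a b c ha hb hc
  by_contra! hne
  have hadj : ∀ {u v}, (u, v) ∈ E ∨ (v, u) ∈ E → D.toSimpleGraphInclusive.Adj u v := fun h =>
    hD.toSimpleGraphInclusive_adj (h.imp (hE _) (hE _))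
  refine hout.no_three_common_neighbors (hD.ne (hE p hp)) ![a, b, c] ?_ ?_ ?_
  · intro i j hij
    fin_cases i <;> fin_cases j <;> simp_all
  · intro i
    fin_cases i
    exacts [hadj ha.1.symm, hadj hb.1.symm, hadj hc.1.symm]
  · intro i
    fin_cases i
    exacts [hadj ha.2, hadj hb.2, hadj hc.2]

/-- The set need not be a whole block: it sits inside a maximal 2-connected subgraph, whose layout
is restricted. -/
theorem Digraph.IsBlockMonotone.exists_layout_of_isTwoConnected {V : Type*} [Finite V]
    {D : Digraph V} (hD : D.IsBlockMonotone) {A : Set V}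
    (hA : IsTwoConnected ((⊤ : D.toSimpleGraphInclusive.Subgraph).induce A).coe) :
    ∃ (pos : V → ℚ) (col : V × V → Fin 5), IsStackLayoutOn A (D.edgesOn A) pos col := by
  obtain ⟨-, hout, hdag, hblock⟩ := hD
  obtain ⟨B, hAB, hB⟩ := Finite.exists_le_maximal
    (p := fun B' : D.toSimpleGraphInclusive.Subgraph => IsTwoConnected B'.coe) hA
  obtain ⟨pos, col, h⟩ := (hblock B (Or.inr hB)).exists_isStackLayoutOn
    (hdag.atMostTwoCommonNeighbors hout fun p hp => hp.1)
  refine ⟨pos, col, h.mono hAB.1 fun p hp => ⟨hp.1, hAB.2 ?_⟩⟩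
  exact ⟨hp.2.1, hp.2.2, hdag.toSimpleGraphInclusive_adj (Or.inl hp.1)⟩

/-- With at most two vertices there is at most one edge, since acyclicity forbids opposite edges.
Bridges thus need no appeal to blocks. -/
theorem Digraph.IsDAG.exists_layout_of_encard_lt {V : Type*} [Finite V] {D : Digraph V} (hD : D.IsDAG)
    {A : Set V} (hA : ¬ 3 ≤ A.encard) :
    ∃ (pos : V → ℚ) (col : V × V → Fin 5), IsStackLayoutOn A (D.edgesOn A) pos col := by
  classical
  by_cases h : ∃ a b, (a, b) ∈ D.edgesOn A
  · obtain ⟨a, b, hab, ha, hb⟩ := h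
    have hne : a ≠ b := hD.ne hab
    have hsub : ∀ z ∈ A, z = a ∨ z = b := by
      intro z hz
      by_contra! hcon
      refine hA ?_
      have : ({z, a, b} : Set V) ⊆ A := by
        rintro _ (rfl | rfl | rfl) <;> assumption
      refine le_trans ?_ (Set.encard_le_encard this)
      rw [Set.encard_insert_of_notMem (by simp [hcon.1, hcon.2]), Set.encard_pair hne]
      norm_num
    have hedge : ∀ p ∈ D.edgesOn A, p = (a, b) := by
      rintro ⟨u, v⟩ ⟨huv, hu, hv⟩
      have h1 := hD.ne huv
      rcases hsub u hu with rfl | rfl <;> rcases hsub v hv with rfl | rfl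
      · exact absurd rfl h1
      · rfl
      · exact absurd (.tail (.single hab) huv) (hD _)
      · exact absurd rfl h1
    refine ⟨fun v => if v = a then 0 else 1, fun _ => 0, ?_, ?_, ?_⟩
    · intro u hu v hv huv
      rcases hsub u hu with rfl | rfl <;> rcases hsub v hv with rfl | rfl <;>
        simp_all [hne.symm]
    · intro p hp
      rw [hedge p hp]; simp [hne.symm]
    · intro p hp q hq _ hcross
      rw [hedge p hp, hedge q hq] at hcross
      exact lt_irrefl _ hcross.1
  · push Not at h
    obtain ⟨f, hf⟩ := exists_injective_nat V
    exact ⟨fun v => f v, fun _ => 0, fun u _ v _ huv => hf (by exact_mod_cast huv),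
      fun p hp => absurd hp (h _ _), fun p hp => absurd hp (h _ _)⟩

/-- Induction over all connected vertex sets avoids the block tree: a set with at least three
vertices either is 2-connected or splits at a cut vertex `c` into two smaller connected sets sharing
only `c`. The side without the root is rooted at `c`. -/
theorem Digraph.IsBlockMonotone.exists_rootedLayout {V : Type*} [Finite V] {D : Digraph V}
    (hD : D.IsBlockMonotone) (n : ℕ) : ∀ A : Set V, A.ncard = n →
    D.toSimpleGraphInclusive.ConnectedOn A → ∀ r ∈ A,
      ∃ pos col d, RootedLayout (K := Fin 5) D A r pos col d := by
  induction n using Nat.strong_induction_on with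
  | _ n ih =>
  rintro A rfl hA r hr
  have hdag := hD.2.2.1
  by_cases hcard : 3 ≤ A.encard
  swap
  · obtain ⟨pos, col, h⟩ := hdag.exists_layout_of_encard_lt hcard
    obtain ⟨col', d, h'⟩ := h.exists_rootedLayout r
    exact ⟨pos, col', d, h'⟩
  by_cases hcut : ∀ c ∈ A, D.toSimpleGraphInclusive.ConnectedOn (A \ {c})
  · obtain ⟨pos, col, h⟩ :=
      hD.exists_layout_of_isTwoConnected (isTwoConnected_induce_top hcard hA hcut)
    obtain ⟨col', d, h'⟩ := h.exists_rootedLayout r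
    exact ⟨pos, col', d, h'⟩
  push Not at hcut
  obtain ⟨c, hc, hcut⟩ := hcut
  -- The two sides of the cut play symmetric roles except for the position of `r`, so the argument
  -- is set up for whichever side contains it.
  have main : ∀ B B' : Set V, B ⊆ A \ {c} → B' = (A \ {c}) \ B → B.Nonempty → B'.Nonempty →
      (∀ u ∈ B, ∀ v ∈ B', ¬ D.toSimpleGraphInclusive.Adj u v) → r ∈ insert c B →
      ∃ pos col d, RootedLayout (K := Fin 5) D A r pos col d := by
    rintro B B' hB hB' ⟨x, hx⟩ ⟨y, hy⟩ hno hrB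
    have hB's : B' ⊆ A \ {c} := hB' ▸ Set.sdiff_subset
    have hBB' : (A \ {c}) \ B' = B := by rw [hB', Set.sdiff_sdiff_cancel_left hB]
    have hdisj : ∀ z, z ∈ B → z ∉ B' := fun z hz hz' => by rw [hB'] at hz'; exact hz'.2 hz
    have hc₁ : c ∉ B := fun h => (hB h).2 rfl
    have hc₂ : c ∉ B' := fun h => (hB's h).2 rfl
    have hs₁ : insert c B ⊆ A := Set.insert_subset hc fun z hz => (hB hz).1
    have hs₂ : insert c B' ⊆ A := Set.insert_subset hc fun z hz => (hB's hz).1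
    have hn₁ : (insert c B).ncard < A.ncard := Set.ncard_lt_ncard
      ⟨hs₁, fun h => (h (hB's hy).1).elim (fun e => hc₂ (e ▸ hy)) fun h => hdisj y h hy⟩
    have hn₂ : (insert c B').ncard < A.ncard := Set.ncard_lt_ncard
      ⟨hs₂, fun h => (h (hB hx).1).elim (fun e => hc₁ (e ▸ hx)) fun h => hdisj x hx h⟩
    have hunion : A = insert c B ∪ insert c B' := by
      refine Set.Subset.antisymm (fun z hz => ?_) (Set.union_subset hs₁ hs₂)
      by_cases hzc : z = c
      · exact Or.inl (Or.inl hzc)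
      by_cases hzB : z ∈ B
      · exact Or.inl (Or.inr hzB)
      · exact Or.inr (Or.inr (by rw [hB']; exact ⟨⟨hz, hzc⟩, hzB⟩))
    obtain ⟨pos₁, col₁, d₁, h₁⟩ := ih _ hn₁ _ rfl
      (hA.insert_of_no_adj hc hB fun u hu v hv => hno u hu v (hB' ▸ hv)) r hrB
    obtain ⟨pos₂, col₂, d₂, h₂⟩ := ih _ hn₂ _ rfl
      (hA.insert_of_no_adj hc hB's fun u hu v hv h => hno v (hBB' ▸ hv) u hu h.symm) c
      (Set.mem_insert c B')
    obtain ⟨col₂', d₂', h₂', hd⟩ := h₂.exists_parity (d₁ c)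
    rw [hunion]
    refine h₁.glue h₂' hrB (Set.mem_insert c B) (Set.mem_insert c B') ?_ hd ?_
    · rintro z ⟨hz | hz, hz' | hz'⟩
      exacts [hz, hz, hz', absurd hz' (hdisj z hz)]
    · rintro ⟨u, v⟩ ⟨huv, hu, hv⟩
      have hadj := hdag.toSimpleGraphInclusive_adj (Or.inl huv)
      by_cases hu₁ : u ∈ insert c B
      · by_cases hv₁ : v ∈ insert c B
        · exact Or.inl ⟨huv, hu₁, hv₁⟩
        · have hv₂ := hv.resolve_left hv₁
          rcases hu₁ with rfl | hu₁
          · exact Or.inr ⟨huv, Set.mem_insert _ _, hv₂⟩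
          · exact absurd hadj (hno u hu₁ v (hv₂.resolve_left fun e => hv₁ (Or.inl e)))
      · have hu₂ := hu.resolve_left hu₁
        by_cases hv₂ : v ∈ insert c B'
        · exact Or.inr ⟨huv, hu₂, hv₂⟩
        · exact absurd hadj.symm (hno v ((hv.resolve_right hv₂).resolve_left
            fun e => hv₂ (Or.inl e)) u (hu₂.resolve_left fun e => hu₁ (Or.inl e)))
  unfold SimpleGraph.ConnectedOn at hcut
  push Not at hcut
  obtain ⟨B, hB, hne, hne', hno⟩ := hcut
  by_cases hrB : r ∈ insert c B
  · exact main B _ hB rfl hne hne' hno hrB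
  · refine main _ B Set.sdiff_subset (Set.sdiff_sdiff_cancel_left hB).symm hne' hne
      (fun u hu v hv h => hno v hv u hu h.symm) (Or.inr ⟨⟨hr, fun e => hrB (Or.inl e)⟩,
        fun h => hrB (Or.inr h)⟩)

theorem mainTheorem6 {V : Type*} [Finite V] (D : Digraph V) (hD : D.IsBlockMonotone) :
    Nonempty (D.StackLayout 258) := by
  obtain ⟨r⟩ := hD.1.nonempty
  obtain ⟨pos, col, d, h⟩ := hD.exists_rootedLayout _ Set.univ rfl hD.1.connectedOn_univ r
    (Set.mem_univ r)
  have hedge : ∀ {a b}, D.Adj a b → (a, b) ∈ D.edgesOn Set.univ := fun hab =>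
    ⟨hab, Set.mem_univ _, Set.mem_univ _⟩
  -- There are `1 + 2 * 5 = 11` colours in use, well below `258`.
  obtain ⟨f⟩ : Nonempty (Option (Bool × Fin 5) ↪ Fin 258) :=
    Function.Embedding.nonempty_of_card_le (by simp)
  refine ⟨⟨fun a b => pos a < pos b, ?_, fun a b hab => h.layout.lt _ (hedge hab),
    fun e => f (col e.1), ?_⟩⟩
  · exact
      { trichotomous := fun a b h1 h2 => h.layout.inj (Set.mem_univ a) (Set.mem_univ b)
          (le_antisymm (not_lt.1 h2) (not_lt.1 h1))
        irrefl := fun a => lt_irrefl _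
        trans := fun a b c => lt_trans }
  · rintro ⟨p, hp⟩ ⟨q, hq⟩ hpq
    have hpq' : col p = col q := f.injective hpq
    rintro (hc | hc)
    · exact h.layout.noncrossing p (hedge hp) q (hedge hq) hpq' hc
    · exact h.layout.noncrossing q (hedge hq) p (hedge hp) hpq'.symm hc
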